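/- **Setting.** Let $d\ge 2$, let $\Omega\subset\mathbb R^d$ be a bounded domain, $I=(0,T)$ with $T>0$, and let $p\in(1,\infty)$ with $p\ge\frac{2d}{d+2}$, $p'=\frac p{p-1}$, $\delta\in[0,1]$. Put $\varphi'(s)=(\delta+s)^{p-2}s$, $\varphi_a'(s)=\varphi'(a+s)\frac{s}{a+s}$, $\varphi_a(t)=\int_0^t\varphi_a'(s)\,ds$ for $a,t\ge 0$, and $\psi^*(s)=\sup_{t\ge0}(st-\psi(t))$. For $P\in\mathbb R^{d\times d}$ with symmetric part $P^{\rm sym}$ and Hilbert–Schmidt norm $|\cdot|$ put $$S(P)=\frac{\varphi'(|P^{\rm sym}|)}{|P^{\rm sym}|}P^{\rm sym}\quad(S(P)=0\text{ if }P^{\rm sym}=0),\qquad F(P)=(\delta+|P^{\rm sym}|)^{\frac{p-2}2}P^{\rm sym}.$$ $Dw$ denotes the symmetric gradient of a vector field $w$ and $(\cdot,\cdot)$ the $L^2(\Omega)$ pairing. **Continuous problem.** Let $f\in W^{1,2}(I,L^2(\Omega))$ and $u_0\in W^{1,p}_{0,\mathrm{div}}(\Omega)$ with $\nabla F(Du_0),\nabla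 S(Du_0)\in L^2(\Omega)$. Let $(u,q)\in L^p(I,W^{1,p}_{0,\mathrm{div}}(\Omega))\times L^{p'}(I,L^{p'}_0(\Omega))$ be a weak solution of $\partial_tu-\operatorname{div}S(Du)+\nabla q=f$, $\operatorname{div}u=0$ in $I\times\Omega$, $u=0$ on $I\times\partial\Omega$, $u(0)=u_0$, that is, $u(0)=u_0$ and for almost every $t\in I$ $$(\partial_tu(t),\xi)+(S(Du(t)),D\xi)-(q(t),\operatorname{div}\xi)=(f(t),\xi)\qquad\text{for all }\xi\in W^{1,p}_0(\Omega),$$ and assume $u\in W^{1,2}(I,L^2(\Omega))\cap L^2(I,W^{2,2}(\Omega))$, $F(Du)\in W^{1,2}(I\times\Omega)$ and $q\in L^{p'}(I,W^{1,p'}(\Omega))$. For functions in $W^{1,2}(I,L^2(\Omega))$ the representative in $C(\overline I,L^2(\Omega))$ is used. **Discrete problem.** Let $\mathcal T_h$ be a finite conforming decomposition of $\overline\Omega$ into simplices, let $k,r\in\mathbb N_0$, and put $$X_h=\{v\in W^{1,p}_0(\Omega): v|_T\in\mathcal P_k(T)\ \forall T\in\mathcal T_h,\ v|_{\partial\Omega}=0\},\qquad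 Y_h=\{\mu\in L^{p'}(\Omega):\mu|_T\in\mathcal P_r(T)\ \forall T\in\mathcal T_h\},$$ $$V_h=\{v\in X_h:(\mu,\operatorname{div}v)=0\ \forall \mu\in Y_h\}.$$ Let $u_0^h\in V_h$ satisfy $(S(Du_0^h),D\xi)=(S(Du_0),D\xi)$ for all $\xi\in V_h$, and let $u_h\in C^1(\overline I,V_h)$ satisfy $u_h(0)=u_0^h$ and $(\partial_tu_h(t),\xi)+(S(Du_h(t)),D\xi)=(f(t),\xi)$ for all $\xi\in V_h$, $t\in\overline I$. **Proposition.** For every $\kappa$ with $0<\kappa<\frac{8(p-1)}{p^2}$ there is a constant $c>0$ depending only on $d$, $p$ and $\kappa$ (in particular not on $\delta$, $\Omega$, $T$, $\mathcal T_h$, $k$, $r$, the data or the solutions) such that, for almost every $t\in I$, the function $\|u-u_h\|_{L^2(\Omega)}^2$ is differentiable at $t$ and, at time $t$, $$\frac{d}{dt}\|u-u_h\|_{L^2(\Omega)}^2+\kappa\,\|F(Du)-F(Du_h)\|_{L^2(\Omega)}^2\le c\inf_{\zeta_h\in V_h}\Big(\|\partial_t(u-u_h)\|_{L^2(\Omega)}\|u-\zeta_h\|_{L^2(\Omega)}+\|F(Du)-F(D\zeta_h)\|_{L^2(\Omega)}^2\Big)+c\inf_{\mu_h\in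 Y_h}\int_\Omega\big(\varphi_{|Du|}\big)^*(|q-\mu_h|)\,dx .$$ (The choice $\kappa=1$ is allowed exactly for $4-2\sqrt2<p<4+2\sqrt2$.) -/

import Mathlib

open MeasureTheory Set Filter Topology
open scoped ENNReal ContDiff

noncomputable section

namespace PStokes

/-- Vectors in `ℝ^d` with the Euclidean norm. -/
abbrev Vec (d : ℕ) := EuclideanSpace ℝ (Fin d)

/-- Tensors in `ℝ^{d × d}`; the norm is the Hilbert-Schmidt norm and `inner ℝ A B` is `A : B`. -/
abbrev Ten (d : ℕ) := EuclideanSpace ℝ (Fin d × Fin d)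

/-- The symmetric part of a tensor. -/
def symPart {d : ℕ} (A : Ten d) : Ten d :=
  WithLp.toLp 2 (fun ij : Fin d × Fin d => (A (ij.1, ij.2) + A (ij.2, ij.1)) / 2)

/-- The trace of a tensor. -/
def trace {d : ℕ} (A : Ten d) : ℝ := ∑ i, A (i, i)

/-! ### The N-function, the stress tensor and the tensor field `F` -/

/-- `φ'(s) = (δ + s)^(p-2) s`. -/
def phiDeriv (p δ s : ℝ) : ℝ := (δ + s) ^ (p - 2) * s

/-- The derivative `φ_a'(s) = φ'(a + s) s / (a + s)` of the shifted N-function. -/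
def shiftedPhiDeriv (p δ a s : ℝ) : ℝ := phiDeriv p δ (a + s) * (s / (a + s))

/-- The shifted N-function `φ_a(t) = ∫_0^t φ_a'(s) ds`. -/
def shiftedPhi (p δ a t : ℝ) : ℝ := ∫ s in (0 : ℝ)..t, shiftedPhiDeriv p δ a s

/-- The complementary function `ψ^*(s) = sup_{t ≥ 0} (s t - ψ(t))`. -/
def complementary (ψ : ℝ → ℝ) (s : ℝ) : ℝ := sSup ((fun t => s * t - ψ t) '' Ici 0)

/-- The extra stress tensor `S(P) = φ'(|P^sym|) / |P^sym| P^sym`, with `S(P) = 0` if `P^sym = 0`. -/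
def stress {d : ℕ} (p δ : ℝ) (P : Ten d) : Ten d :=
  (phiDeriv p δ ‖symPart P‖ / ‖symPart P‖) • symPart P

/-- `F(P) = (δ + |P^sym|)^((p-2)/2) P^sym`. -/
def tensorF {d : ℕ} (p δ : ℝ) (P : Ten d) : Ten d :=
  (δ + ‖symPart P‖) ^ ((p - 2) / 2) • symPart P

/-! ### Weak derivatives and Sobolev spaces -/

/-- `g` is the weak derivative of `f` in the direction `v` on the open set `U`. -/
def HasWeakPartial {V : Type*} [NormedAddCommGroup V] [NormedSpace ℝ V] [MeasureSpace V]
    (U : Set V) (v : V) (f g : V → ℝ) : Prop :=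
  LocallyIntegrableOn f U ∧ LocallyIntegrableOn g U ∧
    ∀ η : V → ℝ, ContDiff ℝ ∞ η → HasCompactSupport η → tsupport η ⊆ U →
      ∫ x in U, f x * fderiv ℝ η x v = -∫ x in U, g x * η x

/-- The `i`-th unit vector. -/
def unitVec {d : ℕ} (i : Fin d) : Vec d := EuclideanSpace.single i (1 : ℝ)

/-- `G` is the weak gradient of the vector field `w` on `Ω`: `G_{ij} = ∂_i w_j`. -/
def IsWeakGrad {d : ℕ} (Ω : Set (Vec d)) (w : Vec d → Vec d) (G : Vec d → Ten d) : Prop :=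
  ∀ i j, HasWeakPartial Ω (unitVec i) (fun x => w x j) (fun x => G x (i, j))

open Classical in
/-- The weak gradient of `w` on `Ω` (unique almost everywhere), and `0` if there is none. -/
def weakGrad {d : ℕ} (Ω : Set (Vec d)) (w : Vec d → Vec d) : Vec d → Ten d :=
  if h : ∃ G, IsWeakGrad Ω w G then h.choose else 0

/-- The symmetric gradient `D w`. -/
def symGrad {d : ℕ} (Ω : Set (Vec d)) (w : Vec d → Vec d) (x : Vec d) : Ten d :=
  symPart (weakGrad Ω w x)

/-- The divergence of `w`. -/
def divergence {d : ℕ} (Ω : Set (Vec d)) (w : Vec d → Vec d) (x : Vec d) : ℝ :=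
  trace (weakGrad Ω w x)

/-- The classical gradient `(∂_i ψ_j)_{ij}` of a smooth vector field. -/
def classicalGrad {d : ℕ} (ψ : Vec d → Vec d) (x : Vec d) : Ten d :=
  WithLp.toLp 2 (fun ij : Fin d × Fin d => fderiv ℝ ψ x (unitVec ij.1) ij.2)

/-- `w ∈ W_0^{1,p}(Ω)`: `w ∈ W^{1,p}(Ω)` is the limit in the `W^{1,p}`-norm of smooth fields with
compact support in `Ω`. -/
def MemW0 {d : ℕ} (Ω : Set (Vec d)) (p : ℝ) (w : Vec d → Vec d) : Prop :=
  ∃ G : Vec d → Ten d, IsWeakGrad Ω w G ∧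
    MemLp w (ENNReal.ofReal p) (volume.restrict Ω) ∧
    MemLp G (ENNReal.ofReal p) (volume.restrict Ω) ∧
    ∀ ε : ℝ≥0∞, 0 < ε → ∃ ψ : Vec d → Vec d,
      ContDiff ℝ ∞ ψ ∧ HasCompactSupport ψ ∧ tsupport ψ ⊆ Ω ∧
      eLpNorm (fun x => w x - ψ x) (ENNReal.ofReal p) (volume.restrict Ω) ≤ ε ∧
      eLpNorm (fun x => G x - classicalGrad ψ x) (ENNReal.ofReal p) (volume.restrict Ω) ≤ ε

/-- `w ∈ W_{0,div}^{1,p}(Ω)`. -/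
def MemW0div {d : ℕ} (Ω : Set (Vec d)) (p : ℝ) (w : Vec d → Vec d) : Prop :=
  MemW0 Ω p w ∧ ∀ᵐ x ∂(volume.restrict Ω), divergence Ω w x = 0

/-- The conjugate exponent `p' = p / (p - 1)`. -/
def conjExp (p : ℝ) : ℝ := p / (p - 1)

/-- The norm of `L^2(Ω)`. -/
def l2norm {d : ℕ} {X : Type*} [NormedAddCommGroup X] (Ω : Set (Vec d)) (w : Vec d → X) : ℝ :=
  (eLpNorm w 2 (volume.restrict Ω)).toReal

/-- The space-time cylinder `I × Ω` with `I = (0, T)`. -/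
def cylinder {d : ℕ} (T : ℝ) (Ω : Set (Vec d)) : Set (ℝ × Vec d) := Ioo 0 T ×ˢ Ω

/-- `w ∈ L^r(I, L^r(Ω)) = L^r(I × Ω)`. -/
def MemLpST {d : ℕ} {X : Type*} [NormedAddCommGroup X] (T : ℝ) (Ω : Set (Vec d)) (r : ℝ≥0∞)
    (w : ℝ → Vec d → X) : Prop :=
  MemLp (fun z : ℝ × Vec d => w z.1 z.2) r (volume.restrict (cylinder T Ω))

/-- `w ∈ W^{1,2}(I, L^2(Ω))` with weak time derivative `w'`, where `w` is the representative that
is continuous from `[0, T]` to `L^2(Ω)`. -/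
structure IsW12Time {d : ℕ} (T : ℝ) (Ω : Set (Vec d)) (w w' : ℝ → Vec d → Vec d) : Prop where
  memLp : MemLpST T Ω 2 w
  memLp_deriv : MemLpST T Ω 2 w'
  weak_deriv : ∀ i, HasWeakPartial (cylinder T Ω) ((1, 0) : ℝ × Vec d)
    (fun z => w z.1 z.2 i) (fun z => w' z.1 z.2 i)
  memLp_slice : ∀ t ∈ Icc 0 T, MemLp (w t) 2 (volume.restrict Ω)
  continuous : ∀ t ∈ Icc 0 T,
    Tendsto (fun s => eLpNorm (fun x => w s x - w t x) 2 (volume.restrict Ω))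
      (𝓝[Icc 0 T] t) (𝓝 0)

/-- `G` is a (jointly measurable) spatial weak gradient of `w` on `I × Ω`. -/
def IsSpatialGrad {d : ℕ} (T : ℝ) (Ω : Set (Vec d)) (w : ℝ → Vec d → Vec d)
    (G : ℝ → Vec d → Ten d) : Prop :=
  ∀ᵐ t ∂(volume.restrict (Ioo 0 T)), IsWeakGrad Ω (w t) (G t)

/-- The tensor field `A` has a weak gradient in `L^2(Ω)`. -/
def HasL2Grad {d : ℕ} (Ω : Set (Vec d)) (A : Vec d → Ten d) : Prop :=
  ∀ (k : Fin d) (ij : Fin d × Fin d), ∃ g : Vec d → ℝ, MemLp g 2 (volume.restrict Ω) ∧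
    HasWeakPartial Ω (unitVec k) (fun x => A x ij) g

/-- `A ∈ W^{1,2}(I × Ω)`. -/
def MemW12ST {d : ℕ} (T : ℝ) (Ω : Set (Vec d)) (A : ℝ → Vec d → Ten d) : Prop :=
  MemLpST T Ω 2 A ∧ ∀ ij : Fin d × Fin d,
    (∃ g : ℝ → Vec d → ℝ, MemLpST T Ω 2 g ∧
      HasWeakPartial (cylinder T Ω) ((1, 0) : ℝ × Vec d)
        (fun z => A z.1 z.2 ij) (fun z => g z.1 z.2)) ∧
    ∀ k : Fin d, ∃ g : ℝ → Vec d → ℝ, MemLpST T Ω 2 g ∧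
      HasWeakPartial (cylinder T Ω) ((0, unitVec k) : ℝ × Vec d)
        (fun z => A z.1 z.2 ij) (fun z => g z.1 z.2)

/-! ### The continuous problem -/

/-- `(u, q) ∈ L^p(I, W_{0,div}^{1,p}(Ω)) × L^{p'}(I, L_0^{p'}(Ω))` is a weak solution of
`∂_t u - div S(Du) + ∇q = f`, `div u = 0`, `u(0) = u₀`, `u = 0` on `∂Ω`; here `ut` is the weak
time derivative of `u`. -/
structure IsWeakSolution {d : ℕ} (p δ T : ℝ) (Ω : Set (Vec d)) (f : ℝ → Vec d → Vec d)
    (u₀ : Vec d → Vec d) (u ut : ℝ → Vec d → Vec d) (q : ℝ → Vec d → ℝ) : Prop where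
  memLp : MemLpST T Ω (ENNReal.ofReal p) u
  memLp_grad : ∃ G, IsSpatialGrad T Ω u G ∧ MemLpST T Ω (ENNReal.ofReal p) G
  memW0div : ∀ᵐ t ∂(volume.restrict (Ioo 0 T)), MemW0div Ω p (u t)
  memLp_pressure : MemLpST T Ω (ENNReal.ofReal (conjExp p)) q
  mean_pressure : ∀ᵐ t ∂(volume.restrict (Ioo 0 T)), ∫ x in Ω, q t x = 0
  initial : ∀ᵐ x ∂(volume.restrict Ω), u 0 x = u₀ x
  equation : ∀ᵐ t ∂(volume.restrict (Ioo 0 T)), ∀ ξ : Vec d → Vec d, MemW0 Ω p ξ →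
    (∫ x in Ω, inner ℝ (ut t x) (ξ x))
      + (∫ x in Ω, inner ℝ (stress p δ (symGrad Ω (u t) x)) (symGrad Ω ξ x))
      - (∫ x in Ω, q t x * divergence Ω ξ x) = ∫ x in Ω, inner ℝ (f t x) (ξ x)

/-- The regularity assumed of the data and of the weak solution. -/
structure IsRegularSolution {d : ℕ} (p δ T : ℝ) (Ω : Set (Vec d)) (f : ℝ → Vec d → Vec d)
    (u₀ : Vec d → Vec d) (u ut : ℝ → Vec d → Vec d) (q : ℝ → Vec d → ℝ) : Prop where
  /-- `f ∈ W^{1,2}(I, L^2(Ω))` -/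
  force : ∃ ft, IsW12Time T Ω f ft
  /-- `u₀ ∈ W_{0,div}^{1,p}(Ω)` -/
  initial : MemW0div Ω p u₀
  /-- `∇F(Du₀) ∈ L^2(Ω)` -/
  initial_F : HasL2Grad Ω (fun x => tensorF p δ (symGrad Ω u₀ x))
  /-- `∇S(Du₀) ∈ L^2(Ω)` -/
  initial_stress : HasL2Grad Ω (fun x => stress p δ (symGrad Ω u₀ x))
  /-- `u ∈ W^{1,2}(I, L^2(Ω))` with weak time derivative `ut` -/
  velocity_time : IsW12Time T Ω u ut
  /-- `u ∈ L^2(I, W^{2,2}(Ω))` and `F(Du) ∈ W^{1,2}(I × Ω)` -/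
  velocity_space : ∃ G, IsSpatialGrad T Ω u G ∧ MemLpST T Ω 2 G ∧
    (∀ (k : Fin d) (ij : Fin d × Fin d), ∃ g : ℝ → Vec d → ℝ, MemLpST T Ω 2 g ∧
      ∀ᵐ t ∂(volume.restrict (Ioo 0 T)),
        HasWeakPartial Ω (unitVec k) (fun x => G t x ij) (g t)) ∧
    MemW12ST T Ω (fun t x => tensorF p δ (G t x))
  /-- `q ∈ L^{p'}(I, W^{1,p'}(Ω))`; that `q ∈ L^{p'}(I × Ω)` is part of `IsWeakSolution` -/
  pressure : ∀ k : Fin d, ∃ g : ℝ → Vec d → ℝ,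
    MemLpST T Ω (ENNReal.ofReal (conjExp p)) g ∧
      ∀ᵐ t ∂(volume.restrict (Ioo 0 T)), HasWeakPartial Ω (unitVec k) (q t) (g t)

/-! ### Finite elements -/

/-- A finite conforming decomposition of (the closure of) `Ω` into `d`-simplices, each given by its
set of `d + 1` vertices; two simplices meet exactly in the face spanned by their common vertices
(which is empty if there are none). -/
structure Triangulation {d : ℕ} (Ω : Set (Vec d)) where
  simplices : Finset (Finset (Vec d))
  card_vertices : ∀ s ∈ simplices, s.card = d + 1
  affineIndependent : ∀ s ∈ simplices, AffineIndependent ℝ ((↑) : s → Vec d)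
  cover : (⋃ s ∈ simplices, convexHull ℝ (s : Set (Vec d))) = closure Ω
  conforming : ∀ s ∈ simplices, ∀ t ∈ simplices,
    convexHull ℝ (s : Set (Vec d)) ∩ convexHull ℝ (t : Set (Vec d))
      = convexHull ℝ ((s : Set (Vec d)) ∩ (t : Set (Vec d)))

/-- `g` coincides on `A` with a polynomial of degree at most `n`. -/
def IsPolyOn {d : ℕ} (n : ℕ) (A : Set (Vec d)) (g : Vec d → ℝ) : Prop :=
  ∃ P : MvPolynomial (Fin d) ℝ, P.totalDegree ≤ n ∧
    ∀ x ∈ A, g x = MvPolynomial.eval (fun i => x i) P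

/-- The space `X_h` of fields in `W_0^{1,p}(Ω)` that are polynomials of degree at most `k` on each
simplex and vanish on the boundary. An element is given by its (continuous) representative that is
polynomial on every closed simplex, extended by zero outside `Ω`. -/
def Xh {d : ℕ} {Ω : Set (Vec d)} (𝒯 : Triangulation Ω) (p : ℝ) (k : ℕ) :
    Set (Vec d → Vec d) :=
  {v | MemW0 Ω p v ∧
    (∀ s ∈ 𝒯.simplices, ∀ j, IsPolyOn k (convexHull ℝ (s : Set (Vec d))) (fun x => v x j)) ∧
    ∀ x, x ∉ Ω → v x = 0}

/-- The space `Y_h` of functions in `L^{p'}(Ω)` that are polynomials of degree at most `r` on (the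
interior of) each simplex. -/
def Yh {d : ℕ} {Ω : Set (Vec d)} (𝒯 : Triangulation Ω) (p : ℝ) (r : ℕ) :
    Set (Vec d → ℝ) :=
  {μ | MemLp μ (ENNReal.ofReal (conjExp p)) (volume.restrict Ω) ∧
    ∀ s ∈ 𝒯.simplices, IsPolyOn r (interior (convexHull ℝ (s : Set (Vec d)))) μ}

/-- The discretely divergence-free space `V_h`. -/
def Vh {d : ℕ} {Ω : Set (Vec d)} (𝒯 : Triangulation Ω) (p : ℝ) (k r : ℕ) :
    Set (Vec d → Vec d) :=
  {v | v ∈ Xh 𝒯 p k ∧ ∀ μ ∈ Yh 𝒯 p r, ∫ x in Ω, μ x * divergence Ω v x = 0}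

/-- The classical time derivative on `[0, T]`. -/
def timeDeriv {d : ℕ} (T : ℝ) (w : ℝ → Vec d → Vec d) (t : ℝ) (x : Vec d) : Vec d :=
  derivWithin (fun s => w s x) (Icc 0 T) t

/-- `w ∈ C^1([0, T], V)` for a finite-dimensional space `V` of functions. -/
def IsC1Curve {d : ℕ} (T : ℝ) (V : Set (Vec d → Vec d)) (w : ℝ → Vec d → Vec d) : Prop :=
  ∃ (n : ℕ) (ξ : Fin n → Vec d → Vec d) (α : Fin n → ℝ → ℝ),
    (∀ i, ξ i ∈ V) ∧ (∀ i, ContDiffOn ℝ 1 (α i) (Icc 0 T)) ∧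
    ∀ t ∈ Icc 0 T, ∀ x, w t x = ∑ i, α i t • ξ i x

/-- `u₀h ∈ V_h` solves `(S(Du₀h), Dξ) = (S(Du₀), Dξ)` for all `ξ ∈ V_h`. -/
def IsDiscreteInitial {d : ℕ} (p δ : ℝ) {Ω : Set (Vec d)} (𝒯 : Triangulation Ω) (k r : ℕ)
    (u₀ u₀h : Vec d → Vec d) : Prop :=
  u₀h ∈ Vh 𝒯 p k r ∧ ∀ ξ ∈ Vh 𝒯 p k r,
    ∫ x in Ω, inner ℝ (stress p δ (symGrad Ω u₀h x)) (symGrad Ω ξ x)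
      = ∫ x in Ω, inner ℝ (stress p δ (symGrad Ω u₀ x)) (symGrad Ω ξ x)

/-- `uh ∈ C^1([0, T], V_h)` is the finite element solution with initial value `u₀h`. -/
structure IsDiscreteSolution {d : ℕ} (p δ T : ℝ) {Ω : Set (Vec d)} (𝒯 : Triangulation Ω)
    (k r : ℕ) (f : ℝ → Vec d → Vec d) (u₀h : Vec d → Vec d) (uh : ℝ → Vec d → Vec d) :
    Prop where
  regular : IsC1Curve T (Vh 𝒯 p k r) uh
  initial : uh 0 = u₀h
  equation : ∀ t ∈ Icc 0 T, ∀ ξ ∈ Vh 𝒯 p k r,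
    (∫ x in Ω, inner ℝ (timeDeriv T uh t x) (ξ x))
      + (∫ x in Ω, inner ℝ (stress p δ (symGrad Ω (uh t) x)) (symGrad Ω ξ x))
      = ∫ x in Ω, inner ℝ (f t x) (ξ x)

end PStokes

end

open PStokes

namespace PStokes

/-! ### Real powers -/

/-! At almost every time the derivative of `‖u - u_h‖²` is `2 (∂_t(u - u_h), u - u_h)`. Split `u -
u_h = (u - ζ) + (ζ - u_h)` with `ζ ∈ V_h`. The first part is handled by Cauchy-Schwarz. The second
lies in `V_h`, so the error equation turns it into `-2 (S(Du) - S(Du_h), Dζ - Du_h) + 2 (q - μ,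
div(ζ - u_h))`, where any `μ ∈ Y_h` may be subtracted because `ζ - u_h` is discretely
divergence-free.

The rest is pointwise, with `A = Du`, `B = Du_h`, `C = Dζ`. Write `C - B = (A - B) - (A - C)`.
Monotonicity with explicit constant, `(S(A) - S(B)) : (A - B) ≥ 4(p-1)/p² |F(A) - F(B)|²`
(`inner_stress_sub_ge`), yields the good term with factor `8(p-1)/p²`. The gap `η` between this
factor and `κ` pays for the two remaining terms. The mixed term is bounded through `|S(A) - S(B)| ≤
c (δ+|A|+|A-B|)^(p-2) |A-B|`, and the pressure term through Young's inequality for `φ_{|A|}`. In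
both, the weight `(δ+|A|+x)^(p-2) x²`, with `x = |A-B|` or `x = |A-C|`, is dominated by the matching
squared difference of `F`. `exists_pointwise_estimate` collects this; its constant does not see `δ`,
because `δ` and `|A|` enter the weight only through their sum.

The analytic work is to show that `u`, known only through a weak time derivative, is differentiable
almost everywhere as a curve in `L²(Ω)` (`IsW12Time.ae_hasDerivAt_toL2`), and that every nonlinear
term is integrable. The latter includes finiteness of the supremum defining `(φ_{|Du|})^*`, since an
unbounded `sSup` would take the value `0`. -/

theorem rpow_le_const_mul_rpow {L : ℝ} (hL : 1 ≤ L) (β : ℝ) {x y : ℝ} (hx : 0 < x) (hy : 0 < y)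
    (hxy : x ≤ L * y) (hyx : y ≤ L * x) : x ^ β ≤ L ^ |β| * y ^ β := by
  have hL0 : 0 < L := by linarith
  rcases le_total 0 β with hβ | hβ
  · rw [abs_of_nonneg hβ, ← Real.mul_rpow hL0.le hy.le]
    exact Real.rpow_le_rpow hx.le hxy hβ
  · rw [abs_of_nonpos hβ]
    have h := Real.rpow_le_rpow_of_nonpos (x := y / L) (y := x) (by positivity)
      (by rw [div_le_iff₀ hL0]; linarith) hβ
    rwa [Real.div_rpow hy.le hL0.le, div_eq_mul_inv, ← Real.rpow_neg hL0.le, mul_comm] at h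

/-- Mean value inequality on `[M/2, 2M]`, where the derivative of the power is comparable to its
value at `M`. -/
theorem abs_rpow_sub_rpow_le (β : ℝ) {M N : ℝ} (hM : 0 < M) (h1 : M / 2 ≤ N) (h2 : N ≤ 2 * M) :
    |M ^ β - N ^ β| ≤ |β| * 2 ^ |β - 1| * M ^ (β - 1) * |M - N| := by
  have hd : ∀ z ∈ Icc (M / 2) (2 * M), HasDerivWithinAt (fun s : ℝ => s ^ β) (β * z ^ (β - 1))
      (Icc (M / 2) (2 * M)) z := fun z hz =>
    (Real.hasDerivAt_rpow_const (Or.inl (by have := hz.1; linarith))).hasDerivWithinAt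
  have hb : ∀ z ∈ Icc (M / 2) (2 * M), ‖β * z ^ (β - 1)‖ ≤ |β| * 2 ^ |β - 1| * M ^ (β - 1) := by
    intro z hz
    have hz0 : 0 < z := by have := hz.1; linarith
    rw [Real.norm_eq_abs, abs_mul, abs_of_pos (Real.rpow_pos_of_pos hz0 _), mul_assoc]
    exact mul_le_mul_of_nonneg_left (rpow_le_const_mul_rpow one_le_two _ hz0 hM hz.2
      (by have := hz.1; linarith)) (abs_nonneg _)
  have := (convex_Icc (M / 2) (2 * M)).norm_image_sub_le_of_norm_hasDerivWithin_le hd hb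
    (x := N) (y := M) ⟨h1, h2⟩ ⟨by linarith, by linarith⟩
  simpa [Real.norm_eq_abs] using this

/-! ### The radial profile `s ↦ (δ + s)^β s` -/

/-- The radial profile `(δ + s)^β s`. -/
noncomputable def powProfile (δ β s : ℝ) : ℝ := (δ + s) ^ β * s

theorem powProfile_nonneg {δ : ℝ} (hδ : 0 ≤ δ) (β : ℝ) {s : ℝ} (hs : 0 ≤ s) :
    0 ≤ powProfile δ β s := mul_nonneg (Real.rpow_nonneg (by linarith) _) hs

/-- For `β < 0` the product form is singular where `δ + s = 0`. Here the exponent `β + 1` is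
positive, and the second term either vanishes (`δ = 0`) or has base at least `δ > 0`; continuity up
to `0` and concavity arguments become available. -/
theorem powProfile_eq {δ : ℝ} (hδ : 0 ≤ δ) {β : ℝ} (hβ : -1 < β) {s : ℝ} (hs : 0 ≤ s) :
    powProfile δ β s = (δ + s) ^ (β + 1) - δ * (δ + s) ^ β := by
  unfold powProfile
  rcases (add_nonneg hδ hs).eq_or_lt with h | h
  · have h1 : δ = 0 := by linarith
    have h2 : s = 0 := by linarith
    subst h1 h2
    rw [add_zero, Real.zero_rpow (by linarith : β + 1 ≠ 0)]; simp
  · rw [Real.rpow_add h, Real.rpow_one]; ring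

theorem powProfile_continuousOn {δ : ℝ} (hδ : 0 ≤ δ) {β : ℝ} (hβ : -1 < β) :
    ContinuousOn (powProfile δ β) (Ici 0) := by
  refine ContinuousOn.congr (f := fun s => (δ + s) ^ (β + 1) - δ * (δ + s) ^ β) ?_
    (fun s hs => powProfile_eq hδ hβ hs)
  refine ContinuousOn.sub ((by fun_prop : ContinuousOn (fun s => δ + s) (Ici 0)).rpow_const
    fun s _ => Or.inr (by linarith)) ?_
  rcases hδ.eq_or_lt with h | h
  · subst h; simpa using continuousOn_const
  · exact continuousOn_const.mul ((by fun_prop : ContinuousOn (fun s => δ + s) (Ici 0)).rpow_const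
      fun s hs => Or.inl (by have : (0 : ℝ) ≤ s := hs; linarith))

theorem powProfile_hasDerivAt {δ : ℝ} (hδ : 0 ≤ δ) (β : ℝ) {s : ℝ} (hs : 0 < s) :
    HasDerivAt (powProfile δ β) ((δ + s) ^ (β - 1) * ((β + 1) * s + δ)) s := by
  have hpos : 0 < δ + s := by linarith
  have h1 : HasDerivAt (fun s => δ + s) 1 s := (hasDerivAt_id s).const_add δ
  have h := (h1.rpow_const (p := β) (Or.inl hpos.ne')).mul (hasDerivAt_id s)
  have h2 : (δ + s) ^ β = (δ + s) ^ (β - 1) * (δ + s) := by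
    rw [← Real.rpow_add_one hpos.ne']; ring_nf
  refine h.congr_deriv ?_
  rw [h2]; simp only [id]; ring

theorem powProfile_monotoneOn {δ : ℝ} (hδ : 0 ≤ δ) {β : ℝ} (hβ : -1 < β) :
    MonotoneOn (powProfile δ β) (Ici 0) := by
  refine monotoneOn_of_deriv_nonneg (convex_Ici 0) (powProfile_continuousOn hδ hβ) ?_ ?_
  · intro s hs
    rw [interior_Ici] at hs
    exact (powProfile_hasDerivAt hδ β hs).differentiableAt.differentiableWithinAt
  · intro s hs
    rw [interior_Ici] at hs
    have hs' : (0 : ℝ) < s := hs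
    rw [(powProfile_hasDerivAt hδ β hs).deriv]
    have : 0 < δ + s := by linarith
    have : 0 ≤ (β + 1) * s := mul_nonneg (by linarith) hs'.le
    positivity

theorem powProfile_mono {δ : ℝ} (hδ : 0 ≤ δ) {β : ℝ} (hβ : -1 < β) {s t : ℝ} (hs : 0 ≤ s)
    (hst : s ≤ t) : powProfile δ β s ≤ powProfile δ β t :=
  powProfile_monotoneOn hδ hβ hs (hs.trans hst) hst

/-- Comparison of the slopes of the profiles of `S` and `F`. -/
theorem sq_powProfile_sub_le {p δ : ℝ} (hp : 1 < p) (hδ : 0 ≤ δ) {a b : ℝ} (hb : 0 ≤ b)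
    (hba : b ≤ a) :
    4 * (p - 1) / p ^ 2 * (powProfile δ ((p - 2) / 2) a - powProfile δ ((p - 2) / 2) b) ^ 2
      ≤ (powProfile δ (p - 2) a - powProfile δ (p - 2) b) * (a - b) := by
  rcases hba.eq_or_lt with h | h
  · subst h; simp
  set c := 4 * (p - 1) / p ^ 2 with hc
  have hc0 : 0 < c := by have : 0 < p - 1 := by linarith
                         positivity
  set l := (powProfile δ ((p - 2) / 2) a - powProfile δ ((p - 2) / 2) b) / (a - b) with hl
  have hab : 0 < a - b := by linarith
  -- With `l` the difference quotient of the profile of `F`, the derivative of this function is at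
  -- least `c (F' - l)² ≥ 0` once `S' ≥ c (F')²`. This replaces Cauchy-Schwarz for `∫ F'` and needs
  -- no integrability of derivatives near `0`.
  have hmono : MonotoneOn (fun s => powProfile δ (p - 2) s
      - (2 * c * l) * powProfile δ ((p - 2) / 2) s + c * l ^ 2 * s) (Ici 0) := by
    have hder : ∀ s : ℝ, 0 < s → HasDerivAt (fun s => powProfile δ (p - 2) s
      - (2 * c * l) * powProfile δ ((p - 2) / 2) s + c * l ^ 2 * s)
        ((δ + s) ^ (p - 2 - 1) * ((p - 2 + 1) * s + δ)
          - (2 * c * l) * ((δ + s) ^ ((p - 2) / 2 - 1) * (((p - 2) / 2 + 1) * s + δ))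
          + c * l ^ 2 * 1) s := fun s hs =>
      ((powProfile_hasDerivAt hδ _ hs).sub ((powProfile_hasDerivAt hδ _ hs).const_mul _)).add
        ((hasDerivAt_id s).const_mul _)
    refine monotoneOn_of_deriv_nonneg (convex_Ici 0) ?_ ?_ ?_
    · exact ((powProfile_continuousOn hδ (by linarith)).sub
        (continuousOn_const.mul (powProfile_continuousOn hδ (by linarith)))).add (by fun_prop)
    · intro s hs
      rw [interior_Ici] at hs
      exact (hder s hs).differentiableAt.differentiableWithinAt
    · intro s hs
      rw [interior_Ici] at hs
      have hs' : (0 : ℝ) < s := hs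
      rw [(hder s hs).deriv]
      have hpos : 0 < δ + s := by linarith
      set y := (δ + s) ^ ((p - 2) / 2 - 1) with hy
      have hyy : (δ + s) ^ (p - 2 - 1) = y ^ 2 * (δ + s) := by
        rw [hy, ← Real.rpow_natCast, ← Real.rpow_mul hpos.le, ← Real.rpow_add_one hpos.ne']
        congr 1; push_cast; ring
      rw [hyy]
      -- The inequality `c (F')² ≤ S'` after removing powers of `δ + s`. Multiplied by `p²`, the
      -- right side exceeds the left by exactly `(p-2)² δ (δ + p s)`; for `δ = 0` there is equality,
      -- which fixes the constant `4(p-1)/p²`.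
      have key : c * (((p - 2) / 2 + 1) * s + δ) ^ 2 ≤ (δ + s) * ((p - 2 + 1) * s + δ) := by
        rw [hc, div_mul_eq_mul_div, div_le_iff₀ (by positivity)]
        nlinarith [mul_nonneg (mul_nonneg hδ (by positivity : 0 ≤ δ + p * s)) (sq_nonneg (p - 2))]
      nlinarith [mul_le_mul_of_nonneg_left key (sq_nonneg y),
        mul_nonneg hc0.le (sq_nonneg (y * (((p - 2) / 2 + 1) * s + δ) - l))]
  have h1 := hmono (mem_Ici.2 hb) (mem_Ici.2 (hb.trans hba)) hba
  have h2 : powProfile δ ((p - 2) / 2) a - powProfile δ ((p - 2) / 2) b = l * (a - b) := by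
    rw [hl]; field_simp
  rw [h2]
  simp only at h1
  have h3 : powProfile δ ((p - 2) / 2) a = powProfile δ ((p - 2) / 2) b + l * (a - b) := by linarith
  rw [h3] at h1
  nlinarith

/-- In the form of `powProfile_eq`, the subtracted term is nonincreasing in `s` and only helps. The
leading power is concave, and Bernoulli's inequality places it below its tangent at `a`. -/
theorem powProfile_sub_ge {δ : ℝ} (hδ : 0 ≤ δ) {β : ℝ} (hβ : -1 < β) (hβ0 : β ≤ 0) {a b : ℝ}
    (hb : 0 ≤ b) (hba : b ≤ a) :
    (β + 1) * (δ + a) ^ β * (a - b) ≤ powProfile δ β a - powProfile δ β b := by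
  rcases (add_nonneg hδ (hb.trans hba)).eq_or_lt with h | h
  · have : a = 0 := by linarith
    have : b = 0 := by linarith
    subst a b; simp
  rw [powProfile_eq hδ hβ hb, powProfile_eq hδ hβ (hb.trans hba)]
  have h1 : δ * (δ + a) ^ β ≤ δ * (δ + b) ^ β := by
    rcases hδ.eq_or_lt with h' | h'
    · rw [← h']; simp
    · exact mul_le_mul_of_nonneg_left
        (Real.rpow_le_rpow_of_nonpos (by linarith) (by linarith) hβ0) hδ
  have h2 := rpow_one_add_le_one_add_mul_self (s := (b - a) / (δ + a))
    (by rw [le_div_iff₀ h]; linarith) (p := β + 1) (by linarith) (by linarith)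
  have h3 : 1 + (b - a) / (δ + a) = (δ + b) / (δ + a) := by field_simp; ring
  rw [h3, Real.div_rpow (by linarith) h.le, div_le_iff₀ (Real.rpow_pos_of_pos h _)] at h2
  have h4 : (1 + (β + 1) * ((b - a) / (δ + a))) * (δ + a) ^ (β + 1)
      = (δ + a) ^ (β + 1) - (β + 1) * (δ + a) ^ β * (a - b) := by
    rw [Real.rpow_add h, Real.rpow_one]; field_simp; ring
  linarith

/-! ### Monotonicity and growth of the fields `S` and `F` -/

section PowField

variable {E : Type*} [NormedAddCommGroup E] [InnerProductSpace ℝ E]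

/-- The field `P ↦ (δ + |P|)^β P`; both `S` and `F` are of this form. -/
noncomputable def powField (δ β : ℝ) (P : E) : E := (δ + ‖P‖) ^ β • P

theorem norm_powField {δ : ℝ} (hδ : 0 ≤ δ) (β : ℝ) (P : E) :
    ‖powField δ β P‖ = powProfile δ β ‖P‖ := by
  rw [powField, norm_smul, Real.norm_eq_abs, abs_of_nonneg (by positivity), powProfile]

/-- Separates an angular part, carried by `‖A‖ ‖B‖ - ⟪A, B⟫ ≥ 0`, from a radial part; estimates in
`E` thereby reduce to scalar ones. -/
theorem inner_powField_sub (δ β : ℝ) (A B : E) :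
    inner ℝ (powField δ β A - powField δ β B) (A - B)
      = ((δ + ‖A‖) ^ β + (δ + ‖B‖) ^ β) * (‖A‖ * ‖B‖ - inner ℝ A B)
        + (powProfile δ β ‖A‖ - powProfile δ β ‖B‖) * (‖A‖ - ‖B‖) := by
  simp only [powField, powProfile, inner_sub_left, inner_sub_right, real_inner_smul_left,
    real_inner_self_eq_norm_sq, real_inner_comm A B]
  ring

theorem norm_sub_sq_eq (A B : E) :
    ‖A - B‖ ^ 2 = 2 * (‖A‖ * ‖B‖ - inner ℝ A B) + (‖A‖ - ‖B‖) ^ 2 := by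
  rw [norm_sub_sq_real]; ring

/-- Both sides split into radial and angular parts. The radial parts compare by
`sq_powProfile_sub_le`. With `x`, `y` the weights of `F` at `A`, `B`, the angular coefficients are
`x² + y²` and `2 c x y`, and `c ≤ 1` because `4(p-1) ≤ p²`. -/
theorem inner_stress_sub_ge {p δ : ℝ} (hp : 1 < p) (hδ : 0 ≤ δ) (A B : E) :
    4 * (p - 1) / p ^ 2 * ‖powField δ ((p - 2) / 2) A - powField δ ((p - 2) / 2) B‖ ^ 2
      ≤ inner ℝ (powField δ (p - 2) A - powField δ (p - 2) B) (A - B) := by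
  set c := 4 * (p - 1) / p ^ 2 with hc
  have hc0 : 0 ≤ c := by have : 0 < p - 1 := by linarith
                         positivity
  have hc1 : c ≤ 1 := by
    rw [hc, div_le_one (by positivity)]; nlinarith [sq_nonneg (p - 2)]
  have hsq : ∀ s : ℝ, 0 ≤ s → ((δ + s) ^ ((p - 2) / 2)) ^ 2 = (δ + s) ^ (p - 2) := by
    intro s hs
    rw [← Real.rpow_natCast, ← Real.rpow_mul (by linarith)]; congr 1; push_cast; ring
  have he : 0 ≤ ‖A‖ * ‖B‖ - inner ℝ A B := by linarith [real_inner_le_norm A B]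
  have hF : ‖powField δ ((p - 2) / 2) A - powField δ ((p - 2) / 2) B‖ ^ 2
      = (powProfile δ ((p - 2) / 2) ‖A‖ - powProfile δ ((p - 2) / 2) ‖B‖) ^ 2
        + 2 * ((δ + ‖A‖) ^ ((p - 2) / 2) * (δ + ‖B‖) ^ ((p - 2) / 2))
          * (‖A‖ * ‖B‖ - inner ℝ A B) := by
    rw [norm_sub_sq_eq, norm_powField hδ, norm_powField hδ]
    simp only [powField, powProfile, real_inner_smul_left, real_inner_smul_right]
    ring
  have h1D : c * (powProfile δ ((p - 2) / 2) ‖A‖ - powProfile δ ((p - 2) / 2) ‖B‖) ^ 2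
      ≤ (powProfile δ (p - 2) ‖A‖ - powProfile δ (p - 2) ‖B‖) * (‖A‖ - ‖B‖) := by
    rcases le_total ‖B‖ ‖A‖ with h | h
    · exact sq_powProfile_sub_le hp hδ (norm_nonneg _) h
    · have := sq_powProfile_sub_le hp hδ (norm_nonneg _) h
      nlinarith
  rw [hF, inner_powField_sub, ← hsq _ (norm_nonneg A), ← hsq _ (norm_nonneg B)]
  set x := (δ + ‖A‖) ^ ((p - 2) / 2)
  set y := (δ + ‖B‖) ^ ((p - 2) / 2)
  have hx : 0 ≤ x := by positivity
  have hy : 0 ≤ y := by positivity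
  have hxy : c * (2 * (x * y)) ≤ x ^ 2 + y ^ 2 := by
    nlinarith [sq_nonneg (x - y), mul_nonneg hx hy,
      mul_nonneg (mul_nonneg hx hy) (sub_nonneg.2 hc1)]
  nlinarith [mul_le_mul_of_nonneg_right hxy he]

/-- For `β ≥ 0` the weights increase with the norm, so the left factor `A - B` is weighted at least
by the mean of the two weights, and `δ + ‖A‖ + ‖A - B‖` is at most three times the larger base. For
`β ≤ 0` that base dominates both others, so its power is the smallest, and the radial part is
`powProfile_sub_ge`. -/
theorem exists_inner_powField_sub_ge {β : ℝ} (hβ : -1 < β) :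
    ∃ c : ℝ, 0 < c ∧ ∀ δ : ℝ, 0 ≤ δ → ∀ A B : E,
      c * (δ + ‖A‖ + ‖A - B‖) ^ β * ‖A - B‖ ^ 2
        ≤ inner ℝ (powField δ β A - powField δ β B) (A - B) := by
  rcases le_total 0 β with h0 | h0
  · refine ⟨1 / (2 * 3 ^ β), by positivity, fun δ hδ A B => ?_⟩
    have hx : ‖A - B‖ ≤ ‖A‖ + ‖B‖ := norm_sub_le A B
    have hg : (δ + ‖A‖ + ‖A - B‖) ^ β ≤ 3 ^ β * ((δ + ‖A‖) ^ β + (δ + ‖B‖) ^ β) := by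
      rw [mul_add, ← Real.mul_rpow (by norm_num) (by positivity),
        ← Real.mul_rpow (by norm_num) (by positivity)]
      rcases le_total ‖A‖ ‖B‖ with h | h
      · refine (Real.rpow_le_rpow (by positivity) ?_ h0).trans
          (le_add_of_nonneg_left (by positivity))
        linarith [norm_nonneg A]
      · refine (Real.rpow_le_rpow (by positivity) ?_ h0).trans
          (le_add_of_nonneg_right (by positivity))
        linarith [norm_nonneg A]
    have hmon : 0 ≤ ((δ + ‖A‖) ^ β - (δ + ‖B‖) ^ β) * (‖A‖ - ‖B‖) := by
      rcases le_total ‖A‖ ‖B‖ with h | h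
      · exact mul_nonneg_of_nonpos_of_nonpos (sub_nonpos.2 (Real.rpow_le_rpow (by positivity)
          (by linarith) h0)) (by linarith)
      · exact mul_nonneg (sub_nonneg.2 (Real.rpow_le_rpow (by positivity)
          (by linarith) h0)) (by linarith)
    have h1 : 1 / (2 * 3 ^ β) * (δ + ‖A‖ + ‖A - B‖) ^ β
        ≤ ((δ + ‖A‖) ^ β + (δ + ‖B‖) ^ β) / 2 := by
      rw [div_mul_eq_mul_div, div_le_iff₀ (by positivity)]
      linarith
    refine (mul_le_mul_of_nonneg_right h1 (sq_nonneg _)).trans ?_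
    rw [inner_powField_sub, norm_sub_sq_eq, powProfile, powProfile]
    have := mul_nonneg hmon (add_nonneg (norm_nonneg A) (norm_nonneg B))
    nlinarith
  · refine ⟨β + 1, by linarith, fun δ hδ A B => ?_⟩
    have hb : ‖B‖ ≤ ‖A‖ + ‖A - B‖ := by
      have := norm_sub_le A (A - B); simpa using this
    have hx := norm_nonneg (A - B)
    have he : 0 ≤ ‖A‖ * ‖B‖ - inner ℝ A B := by linarith [real_inner_le_norm A B]
    have h1 : (β + 1) * (δ + ‖A‖ + ‖A - B‖) ^ β * (2 * (‖A‖ * ‖B‖ - inner ℝ A B))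
        ≤ ((δ + ‖A‖) ^ β + (δ + ‖B‖) ^ β) * (‖A‖ * ‖B‖ - inner ℝ A B) := by
      -- A zero base with negative exponent has the value `0`, which would spoil the comparison of
      -- powers below. If `A` or `B` vanishes, so does the angular term.
      rcases (norm_nonneg A).eq_or_lt with hA | hA
      · simp [norm_eq_zero.1 hA.symm]
      rcases (norm_nonneg B).eq_or_lt with hB | hB
      · simp [norm_eq_zero.1 hB.symm]
      rw [← mul_assoc]
      refine mul_le_mul_of_nonneg_right ?_ he
      have h2 : (δ + ‖A‖ + ‖A - B‖) ^ β ≤ (δ + ‖A‖) ^ β :=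
        Real.rpow_le_rpow_of_nonpos (by positivity) (by linarith) h0
      have h3 : (δ + ‖A‖ + ‖A - B‖) ^ β ≤ (δ + ‖B‖) ^ β :=
        Real.rpow_le_rpow_of_nonpos (by positivity) (by linarith) h0
      have h4 : 0 ≤ (δ + ‖A‖ + ‖A - B‖) ^ β := by positivity
      nlinarith
    have h5 : ∀ a b : ℝ, 0 ≤ b → b ≤ a → δ + a ≤ δ + ‖A‖ + ‖A - B‖ →
        (β + 1) * (δ + ‖A‖ + ‖A - B‖) ^ β * (a - b) ^ 2
          ≤ (powProfile δ β a - powProfile δ β b) * (a - b) := by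
      intro a b hb hba ha
      rcases hba.eq_or_lt with h | h
      · simp [h]
      have h6 := powProfile_sub_ge hδ hβ h0 hb hba
      have h7 : (δ + ‖A‖ + ‖A - B‖) ^ β ≤ (δ + a) ^ β :=
        Real.rpow_le_rpow_of_nonpos (by linarith) ha h0
      have h8 : (β + 1) * (δ + ‖A‖ + ‖A - B‖) ^ β * (a - b)
          ≤ (β + 1) * (δ + a) ^ β * (a - b) := by
        have : 0 ≤ β + 1 := by linarith
        have : 0 ≤ a - b := by linarith
        gcongr
      have h9 : 0 ≤ a - b := by linarith
      nlinarith [mul_le_mul_of_nonneg_right (h8.trans h6) h9]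
    have h10 : (β + 1) * (δ + ‖A‖ + ‖A - B‖) ^ β * (‖A‖ - ‖B‖) ^ 2
        ≤ (powProfile δ β ‖A‖ - powProfile δ β ‖B‖) * (‖A‖ - ‖B‖) := by
      rcases le_total ‖A‖ ‖B‖ with h | h
      · have := h5 _ _ (norm_nonneg A) h (by linarith)
        nlinarith
      · exact h5 _ _ (norm_nonneg B) h (by linarith)
    rw [inner_powField_sub, norm_sub_sq_eq]
    nlinarith

theorem exists_norm_powField_sub_ge {β : ℝ} (hβ : -1 < β) :
    ∃ c : ℝ, 0 < c ∧ ∀ δ : ℝ, 0 ≤ δ → ∀ A B : E,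
      c * (δ + ‖A‖ + ‖A - B‖) ^ β * ‖A - B‖ ≤ ‖powField δ β A - powField δ β B‖ := by
  obtain ⟨c, hc, h⟩ := exists_inner_powField_sub_ge (E := E) hβ
  refine ⟨c, hc, fun δ hδ A B => ?_⟩
  rcases (norm_nonneg (A - B)).eq_or_lt with h0 | h0
  · rw [← h0]; simp
  have := (h δ hδ A B).trans (real_inner_le_norm _ _)
  nlinarith

/-- If `‖A - B‖` is at most half of `m = δ + ‖A‖`, the bases at `A` and `B` are comparable and the
mean value bound for powers applies. Otherwise no cancellation is needed: `‖A‖` and `‖B‖` are both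
at most `3 ‖A - B‖`, and the profile is monotone. -/
theorem exists_norm_powField_sub_le {β : ℝ} (hβ : -1 < β) :
    ∃ C : ℝ, 0 < C ∧ ∀ δ : ℝ, 0 ≤ δ → ∀ A B : E,
      ‖powField δ β A - powField δ β B‖ ≤ C * (δ + ‖A‖ + ‖A - B‖) ^ β * ‖A - B‖ := by
  set K := (1 + 2 * (|β| * 2 ^ |β - 1|)) * (2 : ℝ) ^ |β| with hK
  have hK0 : 0 < K := by positivity
  -- `K` serves the near case; `6` is twice the bound `3` for each field in the far case.
  refine ⟨K + 6, by linarith, fun δ hδ A B => ?_⟩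
  set m := δ + ‖A‖ with hm
  have hm0 : 0 ≤ m := by positivity
  set x := ‖A - B‖ with hx
  have hx0 : 0 ≤ x := norm_nonneg _
  have hw : 0 ≤ (m + x) ^ β := by positivity
  have hb : ‖B‖ ≤ ‖A‖ + x := by
    have := norm_sub_le A (A - B); simpa using this
  have hba : |m - (δ + ‖B‖)| ≤ x := by
    have := abs_norm_sub_norm_le A B
    simpa [hm] using this
  rcases hx0.eq_or_lt with h0 | h0
  · have : A = B := by rw [← sub_eq_zero]; exact norm_eq_zero.1 h0.symm
    subst this; simp; positivity
  rcases le_or_gt x (m / 2) with h | h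
  · have hmp : 0 < m := by linarith
    have hab := abs_le.1 hba
    have h1 := abs_rpow_sub_rpow_le β hmp (N := δ + ‖B‖) (by linarith) (by linarith)
    have h2 : powField δ β A - powField δ β B
        = m ^ β • (A - B) + (m ^ β - (δ + ‖B‖) ^ β) • B := by
      simp only [powField, smul_sub, sub_smul, hm]; abel
    have h3 : m ^ (β - 1) * m = m ^ β := by rw [← Real.rpow_add_one hmp.ne']; ring_nf
    have h4 : m ^ β ≤ 2 ^ |β| * (m + x) ^ β :=
      rpow_le_const_mul_rpow one_le_two β hmp (by linarith) (by linarith) (by linarith)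
    have h5 : ‖powField δ β A - powField δ β B‖
        ≤ m ^ β * x + |β| * 2 ^ |β - 1| * m ^ (β - 1) * x * (2 * m) := by
      rw [h2]
      refine (norm_add_le _ _).trans ?_
      rw [norm_smul, norm_smul, Real.norm_eq_abs, Real.norm_eq_abs, abs_of_nonneg (by positivity)]
      gcongr
      · exact h1.trans (mul_le_mul_of_nonneg_left hba (by positivity))
      · linarith
    calc _ ≤ _ := h5
      _ = (1 + 2 * (|β| * 2 ^ |β - 1|)) * m ^ β * x := by rw [← h3]; ring
      _ ≤ (1 + 2 * (|β| * 2 ^ |β - 1|)) * (2 ^ |β| * (m + x) ^ β) * x := by gcongr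
      _ = K * (m + x) ^ β * x := by rw [hK]; ring
      _ ≤ (K + 6) * (m + x) ^ β * x := by gcongr; linarith
  · have h1 : ∀ P : E, ‖P‖ ≤ ‖A‖ + x → ‖powField δ β P‖ ≤ 3 * (m + x) ^ β * x := by
      intro P hP
      rw [norm_powField hδ]
      refine (powProfile_mono hδ hβ (norm_nonneg _) hP).trans ?_
      rw [powProfile, ← add_assoc, ← hm]
      have : ‖A‖ + x ≤ 3 * x := by linarith
      nlinarith
    have h2 := h1 A (by linarith)
    have h3 := h1 B hb
    refine (norm_sub_le _ _).trans ?_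
    have : 0 ≤ K * (m + x) ^ β * x := by positivity
    linarith

end PowField

/-- The weight `(m + x)^(p-2) x^2`. -/
noncomputable def quadWeight (p m x : ℝ) : ℝ := (m + x) ^ (p - 2) * x ^ 2

theorem quadWeight_nonneg (p : ℝ) {m x : ℝ} (hm : 0 ≤ m) (hx : 0 ≤ x) : 0 ≤ quadWeight p m x := by
  unfold quadWeight; positivity

/-- Either `y ≤ ε x`, and the product is absorbed directly, or `x < y / ε`, and monotonicity of `s ↦
(m + s)^(p-2) s` replaces `x` by `y / ε`. The shift `m` never enters the constant. -/
theorem exists_mixed_le_quadWeight {p : ℝ} (hp : 1 < p) {ε : ℝ} (hε : 0 < ε) :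
    ∃ C : ℝ, 0 < C ∧ ∀ m x y : ℝ, 0 ≤ m → 0 ≤ x → 0 ≤ y →
      (m + x) ^ (p - 2) * x * y ≤ ε * quadWeight p m x + C * quadWeight p m y := by
  wlog hε1 : ε ≤ 1 generalizing ε
  · obtain ⟨C, hC, h⟩ := this one_pos le_rfl
    refine ⟨C, hC, fun m x y hm hx hy => (h m x y hm hx hy).trans ?_⟩
    have := quadWeight_nonneg p hm hx
    nlinarith
  have h1ε : 1 ≤ 1 / ε := by rw [le_div_iff₀ hε]; linarith
  refine ⟨(1 / ε) ^ |p - 2| * (1 / ε), by positivity, fun m x y hm hx hy => ?_⟩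
  have hQx := quadWeight_nonneg p hm hx
  have hQy := quadWeight_nonneg p hm hy
  rcases le_or_gt y (ε * x) with h | h
  · have : (m + x) ^ (p - 2) * x * y ≤ (m + x) ^ (p - 2) * x * (ε * x) := by gcongr
    have h2 : (m + x) ^ (p - 2) * x * (ε * x) = ε * quadWeight p m x := by
      unfold quadWeight; ring
    have h3 : 0 ≤ (1 / ε) ^ |p - 2| * (1 / ε) * quadWeight p m y := by positivity
    linarith
  · have hy0 : 0 < y := by
      have := mul_nonneg hε.le hx; linarith
    have hxy : x ≤ y * (1 / ε) := by rw [mul_one_div, le_div_iff₀ hε]; linarith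
    have h1 := powProfile_mono hm (β := p - 2) (by linarith) hx hxy
    unfold powProfile at h1
    have hle : y ≤ y * (1 / ε) := le_mul_of_one_le_right hy0.le h1ε
    have h2 : (m + y * (1 / ε)) ^ (p - 2) ≤ (1 / ε) ^ |p - 2| * (m + y) ^ (p - 2) := by
      refine rpow_le_const_mul_rpow h1ε _ (by positivity) (by positivity) ?_ ?_
      · nlinarith [mul_le_mul_of_nonneg_left h1ε hm]
      · nlinarith [mul_le_mul_of_nonneg_left h1ε hm,
          mul_le_mul_of_nonneg_left h1ε (mul_nonneg hy0.le (by positivity : 0 ≤ 1 / ε))]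
    calc (m + x) ^ (p - 2) * x * y ≤ (m + y * (1 / ε)) ^ (p - 2) * (y * (1 / ε)) * y := by gcongr
      _ ≤ (1 / ε) ^ |p - 2| * (m + y) ^ (p - 2) * (y * (1 / ε)) * y := by gcongr
      _ = (1 / ε) ^ |p - 2| * (1 / ε) * quadWeight p m y := by unfold quadWeight; ring
      _ ≤ _ := le_add_of_nonneg_left (by positivity)

/-! ### The shifted N-function and its complementary function -/

theorem shiftedPhiDeriv_eq (p δ : ℝ) {a s : ℝ} (ha : 0 ≤ a) (hs : 0 ≤ s) :
    shiftedPhiDeriv p δ a s = powProfile (δ + a) (p - 2) s := by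
  unfold shiftedPhiDeriv phiDeriv powProfile
  rcases (add_nonneg ha hs).eq_or_lt with h | h
  · have : s = 0 := by linarith
    subst this; simp
  · rw [← add_assoc, mul_assoc, mul_div_cancel₀ _ h.ne']

theorem powProfile_intervalIntegrable {δ : ℝ} (hδ : 0 ≤ δ) {β : ℝ} (hβ : -1 < β) {s t : ℝ}
    (hs : 0 ≤ s) (ht : 0 ≤ t) : IntervalIntegrable (powProfile δ β) volume s t :=
  ((powProfile_monotoneOn hδ hβ).mono fun _ hx =>
    (le_inf hs ht).trans hx.1).intervalIntegrable

theorem shiftedPhi_eq (p δ : ℝ) {a t : ℝ} (ha : 0 ≤ a) (ht : 0 ≤ t) :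
    shiftedPhi p δ a t = ∫ s in (0 : ℝ)..t, powProfile (δ + a) (p - 2) s := by
  unfold shiftedPhi
  refine intervalIntegral.integral_congr fun s hs => ?_
  rw [uIcc_of_le ht] at hs
  exact shiftedPhiDeriv_eq p δ ha hs.1

section ShiftedPhi

variable {p δ a : ℝ}

theorem shiftedPhi_le (hp : 1 < p) (hδ : 0 ≤ δ) (ha : 0 ≤ a) {t : ℝ} (ht : 0 ≤ t) :
    shiftedPhi p δ a t ≤ quadWeight p (δ + a) t := by
  rw [shiftedPhi_eq p δ ha ht]
  have h := intervalIntegral.integral_mono_on ht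
    (powProfile_intervalIntegrable (add_nonneg hδ ha) (β := p - 2) (by linarith) le_rfl ht)
    (intervalIntegrable_const (c := powProfile (δ + a) (p - 2) t))
    (fun s hs => powProfile_mono (add_nonneg hδ ha) (by linarith) hs.1 hs.2)
  refine h.trans_eq ?_
  rw [intervalIntegral.integral_const, smul_eq_mul, sub_zero, powProfile, quadWeight]; ring

/-- The increasing integrand is kept only on `[t/2, t]` and bounded below by its value at `t/2`; the
factor `4` comes from the two halvings, and `2 ^ |p - 2|` from halving `t` inside the power. -/
theorem shiftedPhi_ge (hp : 1 < p) (hδ : 0 ≤ δ) (ha : 0 ≤ a) {t : ℝ} (ht : 0 ≤ t) :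
    (2 ^ |p - 2| * 4)⁻¹ * quadWeight p (δ + a) t ≤ shiftedPhi p δ a t := by
  rcases ht.eq_or_lt with h0 | h0
  · subst h0; simp [quadWeight, shiftedPhi]
  have hm := add_nonneg hδ ha
  have hβ : -1 < p - 2 := by linarith
  rw [shiftedPhi_eq p δ ha ht, ← intervalIntegral.integral_add_adjacent_intervals
    (powProfile_intervalIntegrable hm hβ le_rfl (by linarith : 0 ≤ t / 2))
    (powProfile_intervalIntegrable hm hβ (by linarith : 0 ≤ t / 2) ht)]
  have h1 : 0 ≤ ∫ s in (0 : ℝ)..t / 2, powProfile (δ + a) (p - 2) s :=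
    intervalIntegral.integral_nonneg (by linarith) fun s hs => powProfile_nonneg hm _ hs.1
  have h2 := intervalIntegral.integral_mono_on (by linarith : t / 2 ≤ t)
    (intervalIntegrable_const (c := powProfile (δ + a) (p - 2) (t / 2)))
    (powProfile_intervalIntegrable hm hβ (by linarith) ht)
    (fun s hs => powProfile_mono hm hβ (by linarith) hs.1)
  have h3 : (δ + a + t) ^ (p - 2) ≤ 2 ^ |p - 2| * (δ + a + t / 2) ^ (p - 2) :=
    rpow_le_const_mul_rpow one_le_two _ (by linarith) (by linarith) (by linarith) (by linarith)
  have h4 : (2 ^ |p - 2| * 4)⁻¹ * quadWeight p (δ + a) t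
      ≤ (t - t / 2) * powProfile (δ + a) (p - 2) (t / 2) := by
    rw [inv_mul_le_iff₀ (by positivity)]
    unfold quadWeight powProfile
    nlinarith [mul_le_mul_of_nonneg_right h3 (sq_nonneg t)]
  simp only [intervalIntegral.integral_const, smul_eq_mul] at h2
  linarith

/-- Compare `s` with `c t^(p-1)`: one of the two terms alone bounds the product. -/
theorem exists_mul_le_rpow_add_rpow (hp : 1 < p) {c : ℝ} (hc : 0 < c) :
    ∃ C : ℝ, 0 < C ∧ ∀ s t : ℝ, 0 ≤ s → 0 ≤ t → s * t ≤ c * t ^ p + C * s ^ conjExp p := by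
  have hp1 : 0 < p - 1 := by linarith
  refine ⟨(c⁻¹) ^ (p - 1)⁻¹, by positivity, fun s t hs ht => ?_⟩
  rcases ht.eq_or_lt with h0 | h0
  · subst h0; rw [mul_zero]; positivity
  rcases le_or_gt s (c * t ^ (p - 1)) with h | h
  · have h1 : t ^ (p - 1) * t = t ^ p := by rw [← Real.rpow_add_one h0.ne']; ring_nf
    have h2 : s * t ≤ c * t ^ p := by rw [← h1, ← mul_assoc]; gcongr
    have h3 : 0 ≤ (c⁻¹) ^ (p - 1)⁻¹ * s ^ conjExp p := by positivity
    linarith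
  · have hs0 : 0 < s := lt_of_le_of_lt (by positivity) h
    have h1 : t ^ (p - 1) ≤ c⁻¹ * s := by
      rw [← div_eq_inv_mul, le_div_iff₀ hc]; linarith
    have h2 : t ≤ (c⁻¹) ^ (p - 1)⁻¹ * s ^ (p - 1)⁻¹ := by
      rw [← Real.mul_rpow (by positivity) hs, Real.le_rpow_inv_iff_of_pos ht (by positivity) hp1]
      exact h1
    have h3 : s * s ^ (p - 1)⁻¹ = s ^ conjExp p := by
      rw [mul_comm, ← Real.rpow_add_one hs0.ne']; congr 1; unfold conjExp; field_simp; ring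
    have h4 : s * t ≤ (c⁻¹) ^ (p - 1)⁻¹ * s ^ conjExp p := by
      rw [← h3]; nlinarith
    have h5 : 0 ≤ c * t ^ p := by positivity
    linarith

/-- For `t ≤ δ + a` the N-function is discarded; for larger `t` it dominates a multiple of `t^p`.
The bound makes the complementary function a genuine supremum and, later, an integrable one. -/
theorem exists_mul_sub_shiftedPhi_le (hp : 1 < p) :
    ∃ C : ℝ, 0 < C ∧ ∀ δ a s t : ℝ, 0 ≤ δ → 0 ≤ a → 0 ≤ s → 0 ≤ t →
      s * t - shiftedPhi p δ a t ≤ C * (s ^ conjExp p + (δ + a) ^ p) := by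
  set c := ((2 : ℝ) ^ |p - 2| * 4)⁻¹ * (2 ^ |p - 2|)⁻¹ with hc
  have hc0 : 0 < c := by positivity
  obtain ⟨C₁, hC₁, h₁⟩ := exists_mul_le_rpow_add_rpow hp hc0
  obtain ⟨C₂, hC₂, h₂⟩ := exists_mul_le_rpow_add_rpow hp one_pos
  refine ⟨C₁ + C₂ + 1, by positivity, fun δ a s t hδ ha hs ht => ?_⟩
  have hm := add_nonneg hδ ha
  have hs' : 0 ≤ s ^ conjExp p := by positivity
  have hm' : 0 ≤ (δ + a) ^ p := by positivity
  have hge := shiftedPhi_ge hp hδ ha ht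
  rcases le_or_gt t (δ + a) with h | h
  · have h3 := h₂ s (δ + a) hs hm
    have h4 : s * t ≤ s * (δ + a) := by gcongr
    have h5 : 0 ≤ (2 ^ |p - 2| * 4)⁻¹ * quadWeight p (δ + a) t :=
      mul_nonneg (by positivity) (quadWeight_nonneg p hm ht)
    nlinarith [mul_nonneg hC₁.le hs', mul_nonneg hC₁.le hm', mul_nonneg hC₂.le hm']
  · have ht0 : 0 < t := by linarith
    have h3 := h₁ s t hs ht
    have h4 : t ^ (p - 2) ≤ 2 ^ |p - 2| * (δ + a + t) ^ (p - 2) :=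
      rpow_le_const_mul_rpow one_le_two _ ht0 (by linarith) (by linarith) (by linarith)
    have h5 : t ^ (p - 2) * t ^ 2 = t ^ p := by
      rw [← Real.rpow_natCast, ← Real.rpow_add ht0]; congr 1; push_cast; ring
    have h6 : c * t ^ p ≤ (2 ^ |p - 2| * 4)⁻¹ * quadWeight p (δ + a) t := by
      rw [hc, mul_assoc]
      refine mul_le_mul_of_nonneg_left ?_ (by positivity)
      rw [inv_mul_le_iff₀ (by positivity), ← h5]
      unfold quadWeight
      nlinarith [mul_le_mul_of_nonneg_right h4 (sq_nonneg t)]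
    nlinarith [mul_nonneg hC₁.le hm', mul_nonneg hC₂.le hm', mul_nonneg hC₂.le hs']

theorem bddAbove_mul_sub_shiftedPhi (hp : 1 < p) (hδ : 0 ≤ δ) (ha : 0 ≤ a) {s : ℝ} (hs : 0 ≤ s) :
    BddAbove ((fun t => s * t - shiftedPhi p δ a t) '' Ici 0) := by
  obtain ⟨C, -, h⟩ := exists_mul_sub_shiftedPhi_le hp
  refine ⟨C * (s ^ conjExp p + (δ + a) ^ p), ?_⟩
  rintro _ ⟨t, ht, rfl⟩
  exact h δ a s t hδ ha hs ht

theorem mul_sub_le_complementary (hp : 1 < p) (hδ : 0 ≤ δ) (ha : 0 ≤ a) {s t : ℝ} (hs : 0 ≤ s)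
    (ht : 0 ≤ t) : s * t - shiftedPhi p δ a t ≤ complementary (shiftedPhi p δ a) s :=
  le_csSup (bddAbove_mul_sub_shiftedPhi hp hδ ha hs) ⟨t, ht, rfl⟩

theorem complementary_nonneg (hp : 1 < p) (hδ : 0 ≤ δ) (ha : 0 ≤ a) {s : ℝ} (hs : 0 ≤ s) :
    0 ≤ complementary (shiftedPhi p δ a) s := by
  have := mul_sub_le_complementary hp hδ ha hs le_rfl
  simpa [shiftedPhi] using this

theorem exists_complementary_le (hp : 1 < p) :
    ∃ C : ℝ, 0 < C ∧ ∀ δ a s : ℝ, 0 ≤ δ → 0 ≤ a → 0 ≤ s →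
      complementary (shiftedPhi p δ a) s ≤ C * (s ^ conjExp p + (δ + a) ^ p) := by
  obtain ⟨C, hC, h⟩ := exists_mul_sub_shiftedPhi_le hp
  refine ⟨C, hC, fun δ a s hδ ha hs => csSup_le (nonempty_Ici.image _) ?_⟩
  rintro _ ⟨t, ht, rfl⟩
  exact h δ a s t hδ ha hs ht

/-- Young's inequality for the shifted N-function. -/
theorem exists_mul_le_quadWeight_add_complementary (hp : 1 < p) {ε : ℝ} (hε : 0 < ε) :
    ∃ C : ℝ, 0 < C ∧ ∀ δ a s x : ℝ, 0 ≤ δ → 0 ≤ a → 0 ≤ s → 0 ≤ x →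
      s * x ≤ ε * quadWeight p (δ + a) x + C * complementary (shiftedPhi p δ a) s := by
  obtain ⟨l, hl0, hl1, hl⟩ : ∃ l : ℝ, 0 < l ∧ l ≤ 1 ∧ ∀ m x : ℝ, 0 ≤ m → 0 ≤ x →
      quadWeight p m (l * x) ≤ ε * l * quadWeight p m x := by
    -- Shrinking the argument by `l ≤ 1` gains a factor `l^(1+θ)` in the weight: `θ = 1` for `p ≥
    -- 2`, and `θ = p - 1` for `p ≤ 2`, where `m + l x ≥ l (m + x)`. The choice of `l` makes `l^θ ≤
    -- ε`; the definition of the supremum at `l x`, divided by `l`, then gives the claim.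
    set θ := min 1 (p - 1) with hθ
    have hθ0 : 0 < θ := lt_min one_pos (by linarith)
    set l := min 1 (ε ^ θ⁻¹) with hl
    have hl0 : 0 < l := lt_min one_pos (by positivity)
    have hl1 : l ≤ 1 := min_le_left _ _
    have hlθ : l ^ θ ≤ ε := by
      rw [← Real.le_rpow_inv_iff_of_pos hl0.le hε.le hθ0]; exact min_le_right _ _
    refine ⟨l, hl0, hl1, fun m x hm hx => ?_⟩
    rcases hx.eq_or_lt with h0 | h0
    · subst h0; simp [quadWeight]
    have h1 : (m + l * x) ^ (p - 2) * l ≤ l ^ θ * (m + x) ^ (p - 2) := by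
      rcases le_total 2 p with h | h
      · have h3 : θ = 1 := min_eq_left (by linarith)
        rw [h3, Real.rpow_one, mul_comm]
        refine mul_le_mul_of_nonneg_left (Real.rpow_le_rpow (by positivity) ?_ (by linarith)) hl0.le
        nlinarith
      · have h3 : θ = p - 1 := min_eq_right (by linarith)
        have h4 : l ^ (p - 1) = l ^ (p - 2) * l := by
          rw [← Real.rpow_add_one hl0.ne']; ring_nf
        rw [h3, h4, mul_right_comm, ← Real.mul_rpow hl0.le (by positivity)]
        refine mul_le_mul_of_nonneg_right
          (Real.rpow_le_rpow_of_nonpos (by positivity) ?_ (by linarith)) hl0.le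
        nlinarith
    unfold quadWeight
    calc (m + l * x) ^ (p - 2) * (l * x) ^ 2 = ((m + l * x) ^ (p - 2) * l) * (l * x ^ 2) := by ring
      _ ≤ (l ^ θ * (m + x) ^ (p - 2)) * (l * x ^ 2) := by gcongr
      _ ≤ (ε * (m + x) ^ (p - 2)) * (l * x ^ 2) := by gcongr
      _ = _ := by ring
  refine ⟨l⁻¹, by positivity, fun δ a s x hδ ha hs hx => ?_⟩
  have h1 := mul_sub_le_complementary hp hδ ha hs (mul_nonneg hl0.le hx)
  have h2 := shiftedPhi_le hp hδ ha (mul_nonneg hl0.le hx)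
  have h3 := hl (δ + a) x (add_nonneg hδ ha) hx
  have h4 : l * (s * x - ε * quadWeight p (δ + a) x) ≤ complementary (shiftedPhi p δ a) s := by
    linarith
  have h5 := (le_inv_mul_iff₀ hl0).2 h4
  linarith

/-! ### Measurability of the complementary function -/

theorem measurable_shiftedPhi (p δ : ℝ) {t : ℝ} (ht : 0 ≤ t) :
    Measurable fun a => shiftedPhi p δ a t := by
  have h : Measurable fun z : ℝ × ℝ => shiftedPhiDeriv p δ z.1 z.2 := by
    unfold shiftedPhiDeriv phiDeriv
    fun_prop
  have h2 : (fun a => shiftedPhi p δ a t)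
      = fun a => ∫ s in Ioc 0 t, shiftedPhiDeriv p δ a s := by
    ext a; rw [shiftedPhi, intervalIntegral.integral_of_le ht]
  rw [h2]
  exact (h.stronglyMeasurable.integral_prod_right (ν := volume.restrict (Ioc 0 t))).measurable

theorem continuousOn_shiftedPhi (hp : 1 < p) (hδ : 0 ≤ δ) (ha : 0 ≤ a) :
    ContinuousOn (shiftedPhi p δ a) (Ici 0) := by
  have h : ∀ b : ℝ, ContinuousOn (shiftedPhi p δ a) (Icc 0 b) := by
    intro b
    rcases lt_or_ge b 0 with hb | hb
    · simp [Icc_eq_empty_of_lt hb]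
    rw [← uIcc_of_le hb]
    refine (intervalIntegral.continuousOn_primitive_interval (μ := volume)
      (f := powProfile (δ + a) (p - 2)) (a := 0) (b := b) ?_).congr ?_
    · rw [uIcc_of_le hb]
      exact (intervalIntegrable_iff_integrableOn_Icc_of_le hb).1
        (powProfile_intervalIntegrable (add_nonneg hδ ha) (by linarith) le_rfl hb)
    · intro t ht
      rw [uIcc_of_le hb] at ht
      exact shiftedPhi_eq p δ ha ht.1
  intro t ht
  refine ((h (t + 1)) t ⟨ht, by linarith⟩).mono_of_mem_nhdsWithin ?_
  rw [← Ici_inter_Iic]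
  exact inter_mem_nhdsWithin _ (Iic_mem_nhds (by linarith))

/-- By continuity in `t` on `[0, ∞)`, nonnegative rationals suffice. A countable supremum preserves
measurability in the shift and in the argument. -/
theorem complementary_eq_iSup (hp : 1 < p) (hδ : 0 ≤ δ) (ha : 0 ≤ a) {s : ℝ} (hs : 0 ≤ s) :
    complementary (shiftedPhi p δ a) s = ⨆ r : ℚ≥0, s * (r : ℝ) - shiftedPhi p δ a r := by
  have hbdd := bddAbove_mul_sub_shiftedPhi hp hδ ha hs
  have hsub : range (fun r : ℚ≥0 => s * (r : ℝ) - shiftedPhi p δ a r)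
      ⊆ (fun t => s * t - shiftedPhi p δ a t) '' Ici 0 := by
    rintro _ ⟨r, rfl⟩; exact ⟨r, mem_Ici.2 (by positivity), rfl⟩
  refine le_antisymm (csSup_le (nonempty_Ici.image _) ?_) (csSup_le_csSup hbdd (range_nonempty _) hsub)
  rintro _ ⟨t, ht, rfl⟩
  have ht' : (0 : ℝ) ≤ t := ht
  have hcont : ContinuousOn (fun t => s * t - shiftedPhi p δ a t) (Ici 0) :=
    (by fun_prop : ContinuousOn (fun t : ℝ => s * t) (Ici 0)).sub (continuousOn_shiftedPhi hp hδ ha)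
  have hex : ∀ n : ℕ, ∃ r : ℚ≥0, t < r ∧ (r : ℝ) < t + 1 / ((n : ℝ) + 1) := by
    intro n
    obtain ⟨r, h1, h2⟩ := exists_rat_btwn (lt_add_of_pos_right t
      (by positivity : (0 : ℝ) < 1 / ((n : ℝ) + 1)))
    have hr : 0 ≤ r := by
      have : (0 : ℝ) < r := lt_of_le_of_lt ht' h1
      exact_mod_cast this.le
    lift r to ℚ≥0 using hr
    exact ⟨r, by exact_mod_cast h1, by exact_mod_cast h2⟩
  choose r hr1 hr2 using hex
  have hlim : Tendsto (fun n => (r n : ℝ)) atTop (𝓝[Ici 0] t) := by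
    refine tendsto_nhdsWithin_iff.2 ⟨?_, Eventually.of_forall fun n => mem_Ici.2 (by positivity)⟩
    refine tendsto_of_tendsto_of_tendsto_of_le_of_le tendsto_const_nhds ?_
      (fun n => (hr1 n).le) (fun n => (hr2 n).le)
    simpa using (tendsto_one_div_add_atTop_nhds_zero_nat (𝕜 := ℝ)).const_add t
  exact le_of_tendsto ((hcont t ht).tendsto.comp hlim)
    (Eventually.of_forall fun n => le_ciSup (hbdd.mono hsub) (r n))

theorem aemeasurable_complementary {X : Type*} [MeasurableSpace X] {μ : Measure X} (hp : 1 < p)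
    (hδ : 0 ≤ δ) {f g : X → ℝ} (hf : AEMeasurable f μ) (hg : AEMeasurable g μ)
    (hf0 : ∀ x, 0 ≤ f x) (hg0 : ∀ x, 0 ≤ g x) :
    AEMeasurable (fun x => complementary (shiftedPhi p δ (f x)) (g x)) μ := by
  have h : (fun x => complementary (shiftedPhi p δ (f x)) (g x))
      = fun x => ⨆ r : ℚ≥0, g x * (r : ℝ) - shiftedPhi p δ (f x) r :=
    funext fun x => complementary_eq_iSup hp hδ (hf0 x) (hg0 x)
  rw [h]
  exact AEMeasurable.iSup fun r => (hg.mul_const _).sub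
    ((measurable_shiftedPhi p δ (by positivity)).comp_aemeasurable hf)

end ShiftedPhi

/-! ### The pointwise estimate -/

theorem exists_quadWeight_le_sq_norm_sub {E : Type*} [NormedAddCommGroup E] [InnerProductSpace ℝ E]
    {p : ℝ} (hp : 1 < p) :
    ∃ c : ℝ, 0 < c ∧ ∀ δ : ℝ, 0 ≤ δ → ∀ A B : E, c * quadWeight p (δ + ‖A‖) ‖A - B‖
      ≤ ‖powField δ ((p - 2) / 2) A - powField δ ((p - 2) / 2) B‖ ^ 2 := by
  obtain ⟨c, hc, h⟩ := exists_norm_powField_sub_ge (E := E) (β := (p - 2) / 2) (by linarith)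
  refine ⟨c ^ 2, by positivity, fun δ hδ A B => ?_⟩
  refine le_trans (le_of_eq ?_) (pow_le_pow_left₀ (by positivity) (h δ hδ A B) 2)
  have : (δ + ‖A‖ + ‖A - B‖) ^ (p - 2) = ((δ + ‖A‖ + ‖A - B‖) ^ ((p - 2) / 2)) ^ 2 := by
    rw [← Real.rpow_natCast, ← Real.rpow_mul (by positivity)]; congr 1; push_cast; ring
  rw [quadWeight, this]; ring

/-- All the nonlinear analysis in one inequality. `K` stands for the norm of the trace, and `s` for
`|q - μ|`. -/
theorem exists_pointwise_estimate {E : Type*} [NormedAddCommGroup E] [InnerProductSpace ℝ E]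
    {p : ℝ} (hp : 1 < p) {κ : ℝ} (hκ : κ < 8 * (p - 1) / p ^ 2) {K : ℝ} (hK : 0 ≤ K) :
    ∃ c : ℝ, 0 < c ∧ ∀ δ : ℝ, 0 ≤ δ → ∀ (A B C : E) (s : ℝ), 0 ≤ s →
      -2 * inner ℝ (powField δ (p - 2) A - powField δ (p - 2) B) (A - B)
          + 2 * inner ℝ (powField δ (p - 2) A - powField δ (p - 2) B) (A - C)
          + 2 * (K * s * ‖C - B‖)
          + κ * ‖powField δ ((p - 2) / 2) A - powField δ ((p - 2) / 2) B‖ ^ 2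
        ≤ c * ‖powField δ ((p - 2) / 2) A - powField δ ((p - 2) / 2) C‖ ^ 2
          + c * complementary (shiftedPhi p δ ‖A‖) s := by
  obtain ⟨c₀, hc₀, hF⟩ := exists_quadWeight_le_sq_norm_sub (E := E) hp
  obtain ⟨C₁, hC₁, hS⟩ := exists_norm_powField_sub_le (E := E) (β := p - 2) (by linarith)
  set η := 8 * (p - 1) / p ^ 2 - κ with hη
  have hη0 : 0 < η := by linarith
  -- Both small parameters are tuned so that the mixed and the pressure terms each cost `η/4` of the
  -- squared `F`-difference of `A` and `B`; doubled, they use up exactly `η`. The denominator `K +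
  -- 1` below allows `K = 0`.
  obtain ⟨C₂, hC₂, hM⟩ := exists_mixed_le_quadWeight hp (ε := c₀ * η / (4 * C₁)) (by positivity)
  obtain ⟨C₃, hC₃, hY⟩ := exists_mul_le_quadWeight_add_complementary hp
    (ε := c₀ * η / (4 * (K + 1))) (by positivity)
  set ε₂ := c₀ * η / (4 * (K + 1)) with hε₂
  refine ⟨2 * C₁ * C₂ / c₀ + η / 2 + 4 * K * C₃, by positivity, fun δ hδ A B C s hs => ?_⟩
  set FB := ‖powField δ ((p - 2) / 2) A - powField δ ((p - 2) / 2) B‖ ^ 2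
  set FC := ‖powField δ ((p - 2) / 2) A - powField δ ((p - 2) / 2) C‖ ^ 2
  set φ := complementary (shiftedPhi p δ ‖A‖) s
  have hφ : 0 ≤ φ := complementary_nonneg hp hδ (norm_nonneg _) hs
  have hFC0 : 0 ≤ FC := sq_nonneg _
  have hB := hF δ hδ A B
  have hC := hF δ hδ A C
  set QB := quadWeight p (δ + ‖A‖) ‖A - B‖
  set QC := quadWeight p (δ + ‖A‖) ‖A - C‖
  have h1 : 4 * (p - 1) / p ^ 2 * FB ≤ _ := inner_stress_sub_ge hp hδ A B
  have h1' : 8 * (p - 1) / p ^ 2 = 2 * (4 * (p - 1) / p ^ 2) := by ring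
  have h2 : inner ℝ (powField δ (p - 2) A - powField δ (p - 2) B) (A - C)
      ≤ η / 4 * FB + C₁ * C₂ / c₀ * FC := by
    have hm := hM (δ + ‖A‖) ‖A - B‖ ‖A - C‖ (by positivity) (norm_nonneg _) (norm_nonneg _)
    calc _ ≤ _ := real_inner_le_norm _ _
      _ ≤ C₁ * (δ + ‖A‖ + ‖A - B‖) ^ (p - 2) * ‖A - B‖ * ‖A - C‖ := by
          gcongr; exact hS δ hδ A B
      _ = C₁ * ((δ + ‖A‖ + ‖A - B‖) ^ (p - 2) * ‖A - B‖ * ‖A - C‖) := by ring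
      _ ≤ C₁ * (c₀ * η / (4 * C₁) * QB + C₂ * QC) := by gcongr
      _ = η / 4 * (c₀ * QB) + C₁ * C₂ / c₀ * (c₀ * QC) := by field_simp
      _ ≤ _ := by gcongr
  have h3 : K * s * ‖C - B‖ ≤ η / 4 * FB + η / 4 * FC + 2 * K * C₃ * φ := by
    have hb := hY δ ‖A‖ s ‖A - B‖ hδ (norm_nonneg _) hs (norm_nonneg _)
    have hc := hY δ ‖A‖ s ‖A - C‖ hδ (norm_nonneg _) hs (norm_nonneg _)
    have htri : ‖C - B‖ ≤ ‖A - B‖ + ‖A - C‖ := by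
      have := norm_sub_le (A - B) (A - C)
      rwa [sub_sub_sub_cancel_left] at this
    have hKε : K * ε₂ ≤ η / 4 * c₀ := by
      rw [hε₂, mul_div_assoc', div_le_iff₀ (by positivity)]
      nlinarith [mul_pos hc₀ hη0]
    have hQB : 0 ≤ QB := quadWeight_nonneg p (by positivity) (norm_nonneg _)
    have hQC : 0 ≤ QC := quadWeight_nonneg p (by positivity) (norm_nonneg _)
    calc K * s * ‖C - B‖ ≤ K * s * (‖A - B‖ + ‖A - C‖) := by gcongr
      _ = K * (s * ‖A - B‖ + s * ‖A - C‖) := by ring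
      _ ≤ K * ((ε₂ * QB + C₃ * φ) + (ε₂ * QC + C₃ * φ)) := by gcongr
      _ = K * ε₂ * QB + K * ε₂ * QC + 2 * K * C₃ * φ := by ring
      _ ≤ η / 4 * c₀ * QB + η / 4 * c₀ * QC + 2 * K * C₃ * φ := by gcongr
      _ = η / 4 * (c₀ * QB) + η / 4 * (c₀ * QC) + 2 * K * C₃ * φ := by ring
      _ ≤ _ := by gcongr
  have h4 : κ * FB = 2 * (4 * (p - 1) / p ^ 2 * FB) - η * FB := by rw [hη]; ring
  have h5 : 0 ≤ (2 * C₁ * C₂ / c₀ + η / 2) * φ := by positivity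
  have h6 : 0 ≤ 4 * K * C₃ * FC := by positivity
  have h7 : 2 * C₁ * C₂ / c₀ = 2 * (C₁ * C₂ / c₀) := by ring
  rw [h7] at h5 ⊢
  linarith

/-! ### Tensors -/

section Tensors

variable {d : ℕ}

/-- The symmetric part as a linear map. -/
noncomputable def symPartₗ (d : ℕ) : Ten d →ₗ[ℝ] Ten d where
  toFun := symPart
  map_add' A B := by ext ij; simp [symPart]; ring
  map_smul' c A := by ext ij; simp [symPart]; ring

/-- The symmetric part as a continuous linear map. -/
noncomputable def symPartL (d : ℕ) : Ten d →L[ℝ] Ten d := (symPartₗ d).toContinuousLinearMap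

/-- The trace as a linear map. -/
noncomputable def traceₗ (d : ℕ) : Ten d →ₗ[ℝ] ℝ where
  toFun := trace
  map_add' A B := by simp [trace, Finset.sum_add_distrib]
  map_smul' c A := by simp [trace, Finset.mul_sum]

/-- The trace as a continuous linear map. -/
noncomputable def traceL (d : ℕ) : Ten d →L[ℝ] ℝ := (traceₗ d).toContinuousLinearMap

theorem traceL_apply (A : Ten d) : traceL d A = trace A := rfl

theorem symPart_sub (A B : Ten d) : symPart (A - B) = symPart A - symPart B :=
  (symPartL d).map_sub A B

theorem symPart_symPart (A : Ten d) : symPart (symPart A) = symPart A := by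
  ext ij; simp [symPart]; ring

theorem trace_symPart (A : Ten d) : trace (symPart A) = trace A := by
  simp [trace, symPart]

theorem stress_eq_powField (p δ : ℝ) (A : Ten d) :
    stress p δ A = powField δ (p - 2) (symPart A) := by
  unfold stress phiDeriv powField
  rcases eq_or_ne (symPart A) 0 with h | h
  · simp [h]
  · rw [mul_div_cancel_right₀ _ (norm_ne_zero_iff.2 h)]

theorem tensorF_eq_powField (p δ : ℝ) (A : Ten d) :
    tensorF p δ A = powField δ ((p - 2) / 2) (symPart A) := rfl

end Tensors

/-! ### Weak derivatives -/

theorem integrable_mul_of_hasCompactSupport {V : Type*} [NormedAddCommGroup V] [MeasureSpace V]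
    [BorelSpace V] {U : Set V} {f η : V → ℝ} (hf : LocallyIntegrableOn f U) (hη : Continuous η) (hc : HasCompactSupport η)
    (hU : tsupport η ⊆ U) : Integrable (fun x => f x * η x) := by
  have h1 : IntegrableOn (fun x => f x * η x) (tsupport η) :=
    (hf.integrableOn_compact_subset hU hc).mul_continuousOn hη.continuousOn hc
  refine (integrableOn_iff_integrable_of_support_subset ?_).1 h1
  intro x hx
  exact subset_tsupport _ fun h => hx (by simp [h])

section WeakPartial

variable {V : Type*} [NormedAddCommGroup V] [NormedSpace ℝ V] [MeasureSpace V]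

variable {U : Set V} {v : V}

theorem HasWeakPartial.add [BorelSpace V] {f₁ f₂ g₁ g₂ : V → ℝ} (h₁ : HasWeakPartial U v f₁ g₁)
    (h₂ : HasWeakPartial U v f₂ g₂) :
    HasWeakPartial U v (fun x => f₁ x + f₂ x) (fun x => g₁ x + g₂ x) := by
  refine ⟨h₁.1.add h₂.1, h₁.2.1.add h₂.2.1, fun η hη hc hs => ?_⟩
  have hη' : Continuous fun x => fderiv ℝ η x v :=
    (hη.continuous_fderiv (by simp)).clm_apply continuous_const
  have hc' : HasCompactSupport fun x => fderiv ℝ η x v := hc.fderiv_apply ℝ v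
  have hs' : tsupport (fun x => fderiv ℝ η x v) ⊆ U := (tsupport_fderiv_apply_subset ℝ v).trans hs
  simp only [add_mul]
  rw [integral_add (integrable_mul_of_hasCompactSupport h₁.1 hη' hc' hs').integrableOn
    (integrable_mul_of_hasCompactSupport h₂.1 hη' hc' hs').integrableOn,
    integral_add (integrable_mul_of_hasCompactSupport h₁.2.1 hη.continuous hc hs).integrableOn
    (integrable_mul_of_hasCompactSupport h₂.2.1 hη.continuous hc hs).integrableOn,
    h₁.2.2 η hη hc hs, h₂.2.2 η hη hc hs]
  ring

theorem HasWeakPartial.const_mul (c : ℝ) {f g : V → ℝ} (h : HasWeakPartial U v f g) :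
    HasWeakPartial U v (fun x => c * f x) (fun x => c * g x) := by
  refine ⟨h.1.smul c, h.2.1.smul c, fun η hη hc hs => ?_⟩
  simp only [mul_assoc]
  rw [integral_const_mul, integral_const_mul, h.2.2 η hη hc hs]
  ring

/-- The difference of two weak derivatives is orthogonal to all test functions in `U`, so the
fundamental lemma applies. -/
theorem HasWeakPartial.ae_eq [FiniteDimensional ℝ V] [BorelSpace V] (hU : IsOpen U)
    {f g₁ g₂ : V → ℝ} (h₁ : HasWeakPartial U v f g₁) (h₂ : HasWeakPartial U v f g₂) :
    g₁ =ᵐ[volume.restrict U] g₂ := by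
  have h := hU.ae_eq_zero_of_integral_contDiff_smul_eq_zero (μ := volume)
    (h₁.2.1.sub h₂.2.1) (fun η hη hc hs => ?_)
  · rw [EventuallyEq, ae_restrict_iff' hU.measurableSet]
    filter_upwards [h] with x hx hxU
    exact sub_eq_zero.1 (hx hxU)
  · have e1 := h₁.2.2 η hη hc hs
    rw [h₂.2.2 η hη hc hs, neg_inj] at e1
    have h0 : ∀ x, x ∉ U → η x = 0 := fun x hx => image_eq_zero_of_notMem_tsupport fun h => hx (hs h)
    rw [setIntegral_eq_integral_of_forall_compl_eq_zero fun x hx => by simp [h0 x hx],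
      setIntegral_eq_integral_of_forall_compl_eq_zero fun x hx => by simp [h0 x hx]] at e1
    have : (fun x => η x • (g₁ - g₂) x) = fun x => g₁ x * η x - g₂ x * η x := by
      ext x; simp; ring
    rw [this, integral_sub (integrable_mul_of_hasCompactSupport h₁.2.1 hη.continuous hc hs)
      (integrable_mul_of_hasCompactSupport h₂.2.1 hη.continuous hc hs), e1, sub_self]

end WeakPartial

section WeakGrad

variable {d : ℕ} {Ω : Set (Vec d)}

theorem IsWeakGrad.add {w₁ w₂ : Vec d → Vec d} {G₁ G₂ : Vec d → Ten d}
    (h₁ : IsWeakGrad Ω w₁ G₁) (h₂ : IsWeakGrad Ω w₂ G₂) : IsWeakGrad Ω (w₁ + w₂) (G₁ + G₂) :=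
  fun i j => (h₁ i j).add (h₂ i j)

theorem IsWeakGrad.const_smul (c : ℝ) {w : Vec d → Vec d} {G : Vec d → Ten d}
    (h : IsWeakGrad Ω w G) : IsWeakGrad Ω (c • w) (c • G) :=
  fun i j => (h i j).const_mul c

theorem IsWeakGrad.ae_eq (hΩ : IsOpen Ω) {w : Vec d → Vec d} {G₁ G₂ : Vec d → Ten d}
    (h₁ : IsWeakGrad Ω w G₁) (h₂ : IsWeakGrad Ω w G₂) : G₁ =ᵐ[volume.restrict Ω] G₂ := by
  have h : ∀ᵐ x ∂(volume.restrict Ω), ∀ ij : Fin d × Fin d, G₁ x ij = G₂ x ij :=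
    ae_all_iff.2 fun ij => (h₁ ij.1 ij.2).ae_eq hΩ (h₂ ij.1 ij.2)
  filter_upwards [h] with x hx
  ext ij; exact hx ij

theorem IsWeakGrad.isWeakGrad_weakGrad {w : Vec d → Vec d} {G : Vec d → Ten d}
    (h : IsWeakGrad Ω w G) : IsWeakGrad Ω w (weakGrad Ω w) := by
  have hex : ∃ G, IsWeakGrad Ω w G := ⟨G, h⟩
  rw [weakGrad, dif_pos hex]
  exact hex.choose_spec

/-- `weakGrad` is an arbitrary choice; this makes it computable up to null sets, and its linearity
below holds only in that sense. -/
theorem IsWeakGrad.weakGrad_ae_eq (hΩ : IsOpen Ω) {w : Vec d → Vec d} {G : Vec d → Ten d}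
    (h : IsWeakGrad Ω w G) : weakGrad Ω w =ᵐ[volume.restrict Ω] G :=
  h.isWeakGrad_weakGrad.ae_eq hΩ h

end WeakGrad

/-! ### The spaces `W_0^{1,p}` and `V_h` -/

section Sobolev

variable {d : ℕ} {Ω : Set (Vec d)} {p : ℝ}

theorem classicalGrad_add {ψ₁ ψ₂ : Vec d → Vec d} (h₁ : Differentiable ℝ ψ₁)
    (h₂ : Differentiable ℝ ψ₂) (x : Vec d) :
    classicalGrad (ψ₁ + ψ₂) x = classicalGrad ψ₁ x + classicalGrad ψ₂ x := by
  ext ij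
  simp [classicalGrad, fderiv_add (h₁ x) (h₂ x)]

theorem classicalGrad_const_smul (c : ℝ) {ψ : Vec d → Vec d} (h : Differentiable ℝ ψ) (x : Vec d) :
    classicalGrad (c • ψ) x = c • classicalGrad ψ x := by
  ext ij
  simp [classicalGrad, fderiv_const_smul (h x)]

theorem aestronglyMeasurable_classicalGrad {ψ : Vec d → Vec d} (h : ContDiff ℝ ∞ ψ)
    (μ : Measure (Vec d)) : AEStronglyMeasurable (classicalGrad ψ) μ := by
  refine Continuous.aestronglyMeasurable ?_
  unfold classicalGrad
  refine (PiLp.continuous_toLp 2 _).comp (continuous_pi fun ij => ?_)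
  exact (EuclideanSpace.proj (𝕜 := ℝ) ij.2).continuous.comp
    ((h.continuous_fderiv (by simp)).clm_apply continuous_const)

theorem MemW0.add (hp : 1 ≤ p) {w₁ w₂ : Vec d → Vec d} (h₁ : MemW0 Ω p w₁) (h₂ : MemW0 Ω p w₂) :
    MemW0 Ω p (w₁ + w₂) := by
  obtain ⟨G₁, g₁, m₁, n₁, a₁⟩ := h₁
  obtain ⟨G₂, g₂, m₂, n₂, a₂⟩ := h₂
  have hp' : 1 ≤ ENNReal.ofReal p := by simpa using hp
  refine ⟨G₁ + G₂, g₁.add g₂, m₁.add m₂, n₁.add n₂, fun ε hε => ?_⟩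
  obtain ⟨ψ₁, c₁, k₁, s₁, b₁, e₁⟩ := a₁ (ε / 2) (ENNReal.half_pos hε.ne')
  obtain ⟨ψ₂, c₂, k₂, s₂, b₂, e₂⟩ := a₂ (ε / 2) (ENNReal.half_pos hε.ne')
  refine ⟨ψ₁ + ψ₂, c₁.add c₂, k₁.add k₂, (tsupport_add ψ₁ ψ₂).trans (union_subset s₁ s₂), ?_, ?_⟩
  · have h : (fun x => (w₁ + w₂) x - (ψ₁ + ψ₂) x)
        = (fun x => w₁ x - ψ₁ x) + fun x => w₂ x - ψ₂ x := by
      ext1 x; simp only [Pi.add_apply]; abel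
    rw [h]
    refine (eLpNorm_add_le (m₁.1.sub c₁.continuous.aestronglyMeasurable)
      (m₂.1.sub c₂.continuous.aestronglyMeasurable) hp').trans ?_
    exact (add_le_add b₁ b₂).trans_eq (ENNReal.add_halves ε)
  · have h : (fun x => (G₁ + G₂) x - classicalGrad (ψ₁ + ψ₂) x)
        = (fun x => G₁ x - classicalGrad ψ₁ x) + fun x => G₂ x - classicalGrad ψ₂ x := by
      ext1 x
      simp only [Pi.add_apply, classicalGrad_add (c₁.differentiable (by simp))
        (c₂.differentiable (by simp))]
      abel
    rw [h]
    refine (eLpNorm_add_le (n₁.1.sub (aestronglyMeasurable_classicalGrad c₁ _))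
      (n₂.1.sub (aestronglyMeasurable_classicalGrad c₂ _)) hp').trans ?_
    exact (add_le_add e₁ e₂).trans_eq (ENNReal.add_halves ε)

theorem MemW0.const_smul (c : ℝ) {w : Vec d → Vec d} (h : MemW0 Ω p w) : MemW0 Ω p (c • w) := by
  obtain ⟨G, g, m, n, a⟩ := h
  refine ⟨c • G, g.const_smul c, m.const_smul c, n.const_smul c, fun ε hε => ?_⟩
  -- For `c = 0` the tolerance is `ε / 0 = ⊤`, and `0 * ⊤ = 0`, so no case distinction is needed.
  obtain ⟨ψ, h₁, k, s, b, e⟩ := a (ε / ‖c‖ₑ) (ENNReal.div_pos hε.ne' (by simp))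
  have hle : ‖c‖ₑ * (ε / ‖c‖ₑ) ≤ ε := ENNReal.mul_div_le
  refine ⟨c • ψ, h₁.const_smul c, k.smul_left (f := fun _ => c),
    (tsupport_smul_subset_right (fun _ => c) ψ).trans s, ?_, ?_⟩
  · have h : (fun x => (c • w) x - (c • ψ) x) = c • fun x => w x - ψ x := by
      ext1 x; simp [smul_sub]
    rw [h, eLpNorm_const_smul]
    exact (mul_le_mul_right b _).trans hle
  · have h : (fun x => (c • G) x - classicalGrad (c • ψ) x)
        = c • fun x => G x - classicalGrad ψ x := by
      ext1 x; simp [smul_sub, classicalGrad_const_smul c (h₁.differentiable (by simp))]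
    rw [h, eLpNorm_const_smul]
    exact (mul_le_mul_right e _).trans hle

theorem MemW0.isWeakGrad_weakGrad {w : Vec d → Vec d} (h : MemW0 Ω p w) :
    IsWeakGrad Ω w (weakGrad Ω w) := by
  obtain ⟨G, g, -⟩ := h
  exact g.isWeakGrad_weakGrad

theorem MemW0.memLp_weakGrad (hΩ : IsOpen Ω) {w : Vec d → Vec d} (h : MemW0 Ω p w) :
    MemLp (weakGrad Ω w) (ENNReal.ofReal p) (volume.restrict Ω) := by
  obtain ⟨G, g, -, n, -⟩ := h
  exact n.ae_eq (g.weakGrad_ae_eq hΩ).symm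

theorem MemW0.memLp_symGrad (hΩ : IsOpen Ω) {w : Vec d → Vec d} (h : MemW0 Ω p w) :
    MemLp (symGrad Ω w) (ENNReal.ofReal p) (volume.restrict Ω) :=
  (symPartL d).comp_memLp' (h.memLp_weakGrad hΩ)

theorem MemW0.memLp_divergence (hΩ : IsOpen Ω) {w : Vec d → Vec d} (h : MemW0 Ω p w) :
    MemLp (divergence Ω w) (ENNReal.ofReal p) (volume.restrict Ω) :=
  (traceL d).comp_memLp' (h.memLp_weakGrad hΩ)

theorem MemW0.weakGrad_add (hΩ : IsOpen Ω) {w₁ w₂ : Vec d → Vec d} (h₁ : MemW0 Ω p w₁)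
    (h₂ : MemW0 Ω p w₂) :
    weakGrad Ω (w₁ + w₂) =ᵐ[volume.restrict Ω] weakGrad Ω w₁ + weakGrad Ω w₂ :=
  (h₁.isWeakGrad_weakGrad.add h₂.isWeakGrad_weakGrad).weakGrad_ae_eq hΩ

theorem MemW0.weakGrad_const_smul (hΩ : IsOpen Ω) (c : ℝ) {w : Vec d → Vec d} (h : MemW0 Ω p w) :
    weakGrad Ω (c • w) =ᵐ[volume.restrict Ω] c • weakGrad Ω w :=
  (h.isWeakGrad_weakGrad.const_smul c).weakGrad_ae_eq hΩ

theorem MemW0.weakGrad_sub (hΩ : IsOpen Ω) {w₁ w₂ : Vec d → Vec d} (h₁ : MemW0 Ω p w₁)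
    (h₂ : MemW0 Ω p w₂) :
    weakGrad Ω (w₁ - w₂) =ᵐ[volume.restrict Ω] weakGrad Ω w₁ - weakGrad Ω w₂ := by
  rw [sub_eq_add_neg, ← neg_one_smul ℝ w₂]
  filter_upwards [h₁.weakGrad_add hΩ (h₂.const_smul (-1)), h₂.weakGrad_const_smul hΩ (-1)]
    with x hx hx'
  rw [hx, Pi.add_apply, hx']
  simp [sub_eq_add_neg]

end Sobolev

/-! ### Integrability of the nonlinear terms -/

theorem powProfile_le {δ : ℝ} (hδ : 0 ≤ δ) {β : ℝ} (hβ : -1 < β) {s : ℝ} (hs : 0 ≤ s) :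
    powProfile δ β s ≤ (δ + s) ^ (β + 1) := by
  rw [powProfile_eq hδ hβ hs]
  have : 0 ≤ δ * (δ + s) ^ β := by positivity
  linarith

theorem holderConjugate_conjExp {p : ℝ} (hp : 1 < p) :
    ENNReal.HolderConjugate (ENNReal.ofReal p) (ENNReal.ofReal (conjExp p)) :=
  (Real.HolderConjugate.conjExponent hp).ennrealOfReal

section Integrability

variable {X E : Type*} [MeasurableSpace X] {μ : Measure X} [NormedAddCommGroup E]
  [InnerProductSpace ℝ E]

theorem integrable_inner_of_memLp {P Q : ℝ≥0∞} [ENNReal.HolderConjugate P Q] {f g : X → E}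
    (hf : MemLp f P μ) (hg : MemLp g Q μ) : Integrable (fun x => inner ℝ (f x) (g x)) μ := by
  refine (hf.norm.integrable_mul hg.norm).mono' (hf.1.inner hg.1) (Eventually.of_forall fun x => ?_)
  exact norm_inner_le_norm _ _

variable [IsFiniteMeasure μ] {p δ : ℝ}

/-- The field is dominated by `(δ + ‖f‖)^(β+1)`. With `β + 1 = p - 1` this puts `S` in `L^{p'}`,
with `β + 1 = p/2` it puts `F` in `L²`. -/
theorem memLp_powField [MeasurableSpace E] [BorelSpace E] [SecondCountableTopology E]
    (hδ : 0 ≤ δ) {β : ℝ} (hβ : -1 < β) {f : X → E} (hf : MemLp f (ENNReal.ofReal p) μ) :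
    MemLp (fun x => powField δ β (f x)) (ENNReal.ofReal (p / (β + 1))) μ := by
  have hβ' : 0 < β + 1 := by linarith
  have hm : Measurable (powField δ β : E → E) := by unfold powField; fun_prop
  have h1 : MemLp (fun x => δ + ‖f x‖) (ENNReal.ofReal p) μ := (memLp_const δ).add hf.norm
  have h2 := h1.norm_rpow_div (ENNReal.ofReal (β + 1))
  rw [← ENNReal.ofReal_div_of_pos hβ', ENNReal.toReal_ofReal hβ'.le] at h2
  refine h2.mono (hm.comp_aemeasurable hf.1.aemeasurable).aestronglyMeasurable
    (Eventually.of_forall fun x => ?_)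
  rw [norm_powField hδ]
  have h3 : 0 ≤ δ + ‖f x‖ := by positivity
  rw [Real.norm_of_nonneg h3, Real.norm_of_nonneg (by positivity)]
  exact powProfile_le hδ hβ (norm_nonneg _)

theorem integrable_complementary {E : Type*} [NormedAddCommGroup E] (hp : 1 < p) (hδ : 0 ≤ δ)
    {f : X → E} {g : X → ℝ}
    (hf : MemLp f (ENNReal.ofReal p) μ) (hg : MemLp g (ENNReal.ofReal (conjExp p)) μ) :
    Integrable (fun x => complementary (shiftedPhi p δ ‖f x‖) |g x|) μ := by
  obtain ⟨C, hC, h⟩ := exists_complementary_le hp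
  have hp0 : 0 < p := by linarith
  have hq0 : 0 < conjExp p := div_pos hp0 (by linarith)
  have h1 : MemLp (fun x => δ + ‖f x‖) (ENNReal.ofReal p) μ := (memLp_const δ).add hf.norm
  have i1 := h1.integrable_norm_rpow'
  have i2 := hg.integrable_norm_rpow'
  rw [ENNReal.toReal_ofReal hp0.le] at i1
  rw [ENNReal.toReal_ofReal hq0.le] at i2
  refine ((i2.add i1).const_mul C).mono' (aemeasurable_complementary hp hδ hf.1.norm.aemeasurable
    (f := fun x => ‖f x‖) (g := fun x => |g x|) hg.1.norm.aemeasurable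
    (fun x => norm_nonneg _) (fun x => abs_nonneg _)).aestronglyMeasurable
    (Eventually.of_forall fun x => ?_)
  have h3 : 0 ≤ δ + ‖f x‖ := by positivity
  rw [Real.norm_of_nonneg (complementary_nonneg hp hδ (norm_nonneg _) (abs_nonneg _))]
  simp only [Pi.add_apply, Real.norm_eq_abs, abs_of_nonneg h3]
  exact h δ _ _ hδ (norm_nonneg _) (abs_nonneg _)

end Integrability

section Tensors

variable {X : Type*} [MeasurableSpace X] {μ : Measure X} [IsFiniteMeasure μ] {d : ℕ} {p δ : ℝ}
  {A : X → Ten d}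

theorem memLp_stress (hp : 1 < p) (hδ : 0 ≤ δ) (hA : MemLp A (ENNReal.ofReal p) μ) :
    MemLp (fun x => stress p δ (A x)) (ENNReal.ofReal (conjExp p)) μ := by
  have h := memLp_powField hδ (β := p - 2) (by linarith) ((symPartL d).comp_memLp' hA)
  have e : p / (p - 2 + 1) = conjExp p := by unfold conjExp; ring_nf
  rw [e] at h
  simp only [stress_eq_powField]
  exact h

theorem memLp_tensorF (hp : 1 < p) (hδ : 0 ≤ δ) (hA : MemLp A (ENNReal.ofReal p) μ) :
    MemLp (fun x => tensorF p δ (A x)) 2 μ := by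
  have h := memLp_powField hδ (β := (p - 2) / 2) (by linarith) ((symPartL d).comp_memLp' hA)
  have e : p / ((p - 2) / 2 + 1) = 2 := by
    have : p ≠ 0 := by linarith
    rw [show (p - 2) / 2 + 1 = p / 2 by ring]; field_simp
  rw [e, ENNReal.ofReal_ofNat] at h
  exact h

end Tensors

/-! ### Finite element spaces -/

section FiniteElements

variable {d : ℕ} {Ω : Set (Vec d)} {𝒯 : Triangulation Ω} {p : ℝ} {k r : ℕ}

theorem IsPolyOn.add {n : ℕ} {A : Set (Vec d)} {g₁ g₂ : Vec d → ℝ} (h₁ : IsPolyOn n A g₁)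
    (h₂ : IsPolyOn n A g₂) : IsPolyOn n A (fun x => g₁ x + g₂ x) := by
  obtain ⟨P₁, d₁, e₁⟩ := h₁
  obtain ⟨P₂, d₂, e₂⟩ := h₂
  refine ⟨P₁ + P₂, (MvPolynomial.totalDegree_add _ _).trans (max_le d₁ d₂), fun x hx => ?_⟩
  simp only [e₁ x hx, e₂ x hx, map_add]

theorem IsPolyOn.const_mul {n : ℕ} {A : Set (Vec d)} (c : ℝ) {g : Vec d → ℝ}
    (h : IsPolyOn n A g) : IsPolyOn n A (fun x => c * g x) := by
  obtain ⟨P, d, e⟩ := h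
  refine ⟨c • P, (MvPolynomial.totalDegree_smul_le _ _).trans d, fun x hx => ?_⟩
  simp only [e x hx, MvPolynomial.smul_eval]

theorem IsPolyOn.continuousOn {n : ℕ} {A : Set (Vec d)} {g : Vec d → ℝ} (h : IsPolyOn n A g) :
    ContinuousOn g A := by
  obtain ⟨P, -, e⟩ := h
  refine ContinuousOn.congr (Continuous.continuousOn ?_) e
  exact (MvPolynomial.continuous_eval P).comp (continuous_pi fun i => by fun_prop)

/-- Finitely many compact simplices cover `Ω`, and the field is continuous on each. Discrete fields
are thus in `L²` for every `p`, without a Sobolev embedding. -/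
theorem Xh.exists_bound {v : Vec d → Vec d} (hv : v ∈ Xh 𝒯 p k) : ∃ M, ∀ x ∈ Ω, ‖v x‖ ≤ M := by
  have h : ∀ s ∈ 𝒯.simplices, ∃ M, ∀ x ∈ convexHull ℝ (s : Set (Vec d)), ‖v x‖ ≤ M := by
    intro s hs
    refine (s.finite_toSet.isCompact_convexHull ℝ).exists_bound_of_continuousOn ?_
    have h1 : ContinuousOn (fun x => WithLp.ofLp (v x)) (convexHull ℝ (s : Set (Vec d))) :=
      continuousOn_pi.2 fun j => (hv.2.1 s hs j).continuousOn
    exact (PiLp.continuous_toLp 2 _).comp_continuousOn h1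
  choose! M hM using h
  refine ⟨∑ s ∈ 𝒯.simplices, |M s|, fun x hx => ?_⟩
  have hx' : x ∈ closure Ω := subset_closure hx
  rw [← 𝒯.cover] at hx'
  simp only [mem_iUnion] at hx'
  obtain ⟨s, hs, hxs⟩ := hx'
  exact (hM s hs x hxs).trans ((le_abs_self _).trans
    (Finset.single_le_sum (f := fun s => |M s|) (fun _ _ => abs_nonneg _) hs))

theorem Xh.memLp_two (hΩ : MeasurableSet Ω) [IsFiniteMeasure (volume.restrict Ω)]
    {v : Vec d → Vec d} (hv : v ∈ Xh 𝒯 p k) : MemLp v 2 (volume.restrict Ω) := by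
  obtain ⟨M, hM⟩ := Xh.exists_bound hv
  obtain ⟨-, -, m, -⟩ := hv.1
  exact MemLp.of_bound m.1 M ((ae_restrict_iff' hΩ).2 (Eventually.of_forall hM))

theorem integrable_mul_divergence (hp : 1 < p) (hΩ : IsOpen Ω) {q : Vec d → ℝ}
    (hq : MemLp q (ENNReal.ofReal (conjExp p)) (volume.restrict Ω)) {v : Vec d → Vec d}
    (hv : MemW0 Ω p v) : Integrable (fun x => q x * divergence Ω v x) (volume.restrict Ω) := by
  have := holderConjugate_conjExp hp
  exact hq.integrable_mul (hv.memLp_divergence hΩ)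

theorem Vh.add (hp : 1 < p) (hΩ : IsOpen Ω) {v w : Vec d → Vec d} (hv : v ∈ Vh 𝒯 p k r)
    (hw : w ∈ Vh 𝒯 p k r) : v + w ∈ Vh 𝒯 p k r := by
  refine ⟨⟨hv.1.1.add hp.le hw.1.1, fun s hs j => (hv.1.2.1 s hs j).add (hw.1.2.1 s hs j),
    fun x hx => by simp [hv.1.2.2 x hx, hw.1.2.2 x hx]⟩, fun q hq => ?_⟩
  have h : (fun x => q x * divergence Ω (v + w) x) =ᵐ[volume.restrict Ω]
      fun x => q x * divergence Ω v x + q x * divergence Ω w x := by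
    filter_upwards [hv.1.1.weakGrad_add hΩ hw.1.1] with x hx
    rw [divergence, hx, Pi.add_apply, ← traceL_apply, map_add, mul_add]
    rfl
  rw [integral_congr_ae h, integral_add (integrable_mul_divergence hp hΩ hq.1 hv.1.1)
    (integrable_mul_divergence hp hΩ hq.1 hw.1.1), hv.2 q hq, hw.2 q hq, add_zero]

theorem Vh.const_smul (hΩ : IsOpen Ω) (c : ℝ) {v : Vec d → Vec d} (hv : v ∈ Vh 𝒯 p k r) :
    c • v ∈ Vh 𝒯 p k r := by
  refine ⟨⟨hv.1.1.const_smul c, fun s hs j => (hv.1.2.1 s hs j).const_mul c,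
    fun x hx => by simp [hv.1.2.2 x hx]⟩, fun q hq => ?_⟩
  have h : (fun x => q x * divergence Ω (c • v) x) =ᵐ[volume.restrict Ω]
      fun x => c * (q x * divergence Ω v x) := by
    filter_upwards [hv.1.1.weakGrad_const_smul hΩ c] with x hx
    rw [divergence, hx, Pi.smul_apply, ← traceL_apply, map_smul, smul_eq_mul, mul_left_comm]
    rfl
  rw [integral_congr_ae h, integral_const_mul, hv.2 q hq, mul_zero]

theorem Vh.sub (hp : 1 < p) (hΩ : IsOpen Ω) {v w : Vec d → Vec d} (hv : v ∈ Vh 𝒯 p k r)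
    (hw : w ∈ Vh 𝒯 p k r) : v - w ∈ Vh 𝒯 p k r := by
  rw [sub_eq_add_neg, ← neg_one_smul ℝ w]
  exact Vh.add hp hΩ hv (Vh.const_smul hΩ _ hw)

theorem Vh.sum (hp : 1 < p) (hΩ : IsOpen Ω) {v₀ : Vec d → Vec d} (hv₀ : v₀ ∈ Vh 𝒯 p k r)
    {ι : Type*} (s : Finset ι) (c : ι → ℝ) {v : ι → Vec d → Vec d} (hv : ∀ i, v i ∈ Vh 𝒯 p k r) :
    ∑ i ∈ s, c i • v i ∈ Vh 𝒯 p k r := by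
  classical
  induction s using Finset.induction_on with
  | empty => rw [Finset.sum_empty, ← zero_smul ℝ v₀]; exact Vh.const_smul hΩ 0 hv₀
  | insert i s hi ih =>
    rw [Finset.sum_insert hi]
    exact Vh.add hp hΩ (Vh.const_smul hΩ _ (hv i)) ih

theorem zero_mem_Yh : (0 : Vec d → ℝ) ∈ Yh 𝒯 p r :=
  ⟨MemLp.zero, fun _ _ => ⟨0, by simp, fun x _ => by simp⟩⟩

end FiniteElements

/-! ### The fundamental lemma in one dimension -/

theorem exists_contDiff_integral_eq_one {T : ℝ} (hT : 0 < T) :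
    ∃ χ : ℝ → ℝ, ContDiff ℝ ∞ χ ∧ HasCompactSupport χ ∧ tsupport χ ⊆ Ioo 0 T ∧
      ∫ t, χ t = 1 := by
  let b : ContDiffBump (T / 2) := ⟨T / 8, T / 4, by positivity, by linarith⟩
  refine ⟨b.normed volume, b.contDiff_normed, b.hasCompactSupport_normed, ?_, b.integral_normed⟩
  rw [b.tsupport_normed_eq, Real.closedBall_eq_Icc]
  intro t ht
  have h1 : T / 2 - T / 4 ≤ t := ht.1
  have h2 : t ≤ T / 2 + T / 4 := ht.2
  constructor <;> linarith

/-- The primitive starting at `a` vanishes to the left of the support trivially, and to the right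
because the total integral is zero. -/
theorem exists_primitive_of_integral_eq_zero {a b : ℝ} {θ : ℝ → ℝ} (hθ : ContDiff ℝ ∞ θ)
    (ha : ∀ t, t ∉ Icc a b → θ t = 0) (h0 : ∫ t, θ t = 0) :
    ∃ Θ : ℝ → ℝ, ContDiff ℝ ∞ Θ ∧ HasCompactSupport Θ ∧ tsupport Θ ⊆ Icc a b ∧
      ∀ t, deriv Θ t = θ t := by
  have hd : ∀ t, HasDerivAt (fun t => ∫ s in a..t, θ s) (θ t) t := fun t =>
    intervalIntegral.integral_hasDerivAt_right (hθ.continuous.intervalIntegrable _ _)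
      (hθ.continuous.stronglyMeasurableAtFilter _ _) hθ.continuous.continuousAt
  have hz : ∀ t, t ∉ Icc a b → ∫ s in a..t, θ s = 0 := by
    intro t ht
    rcases lt_or_ge t a with h | h
    · rw [intervalIntegral.integral_of_ge h.le, ← integral_Icc_eq_integral_Ioc,
        integral_Icc_eq_integral_Ico]
      rw [setIntegral_eq_zero_of_forall_eq_zero, neg_zero]
      intro s hs
      exact ha s fun h' => absurd hs.2 (not_lt.2 h'.1)
    · rw [intervalIntegral.integral_of_le h, ← integral_Icc_eq_integral_Ioc,
        setIntegral_eq_integral_of_forall_compl_eq_zero, h0]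
      intro s hs
      exact ha s fun h' => hs ⟨h'.1, h'.2.trans (not_le.1 fun h'' => ht ⟨h, h''⟩).le⟩
  have hts : tsupport (fun t => ∫ s in a..t, θ s) ⊆ Icc a b :=
    closure_minimal (fun t ht => by_contra fun h => ht (hz t h)) isClosed_Icc
  have hderiv : deriv (fun t => ∫ s in a..t, θ s) = θ := funext fun t => (hd t).deriv
  refine ⟨fun t => ∫ s in a..t, θ s, ?_, isCompact_Icc.of_isClosed_subset (isClosed_tsupport _) hts,
    hts, fun t => (hd t).deriv⟩
  rw [contDiff_infty_iff_deriv, hderiv]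
  exact ⟨fun t => (hd t).differentiableAt, hθ⟩

theorem exists_subset_Icc_of_isCompact {T : ℝ} (hT : 0 < T) {K : Set ℝ} (hK : IsCompact K)
    (hKT : K ⊆ Ioo 0 T) : ∃ a b : ℝ, 0 < a ∧ b < T ∧ K ⊆ Icc a b := by
  rcases K.eq_empty_or_nonempty with h | h
  · exact ⟨T / 2, T / 2, by linarith, by linarith, by simp [h]⟩
  · exact ⟨sInf K, sSup K, (hKT (hK.sInf_mem h)).1, (hKT (hK.sSup_mem h)).2,
      fun t ht => ⟨csInf_le hK.bddBelow ht, le_csSup hK.bddAbove ht⟩⟩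

/-- The lemma of du Bois-Reymond. -/
theorem exists_eq_const_of_integral_deriv_eq_zero {T : ℝ} (hT : 0 < T) {e : ℝ → ℝ}
    (he : ContinuousOn e (Icc 0 T))
    (h : ∀ χ : ℝ → ℝ, ContDiff ℝ ∞ χ → HasCompactSupport χ → tsupport χ ⊆ Ioo 0 T →
      ∫ t in Ioo 0 T, e t * deriv χ t = 0) : ∃ c, ∀ t ∈ Icc 0 T, e t = c := by
  obtain ⟨χ₀, c₀, k₀, s₀, i₀⟩ := exists_contDiff_integral_eq_one hT
  have hloc : LocallyIntegrableOn e (Ioo 0 T) :=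
    (he.mono Ioo_subset_Icc_self).locallyIntegrableOn measurableSet_Ioo
  set c := ∫ t in Ioo 0 T, e t * χ₀ t with hc
  have hae : ∀ᵐ t ∂(volume : Measure ℝ), t ∈ Ioo 0 T → e t - c = 0 := by
    refine isOpen_Ioo.ae_eq_zero_of_integral_contDiff_smul_eq_zero (f := fun t => e t - c)
      (hloc.sub (locallyIntegrableOn_const c)) fun ψ cψ kψ sψ => ?_
    set m := ∫ t, ψ t with hm
    -- Removing the mean of `ψ` by a multiple of `χ₀` makes it the derivative of an admissible test
    -- function; the constant `c` is the pairing of `e` with `χ₀`.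
    set θ : ℝ → ℝ := fun t => ψ t - m * χ₀ t with hθ
    have hψi : Integrable ψ := cψ.continuous.integrable_of_hasCompactSupport kψ
    have hχi : Integrable χ₀ := c₀.continuous.integrable_of_hasCompactSupport k₀
    obtain ⟨a, b, ha, hb, hab⟩ := exists_subset_Icc_of_isCompact hT (kψ.isCompact.union k₀.isCompact)
      (union_subset sψ s₀)
    obtain ⟨Θ, cΘ, kΘ, sΘ, dΘ⟩ := exists_primitive_of_integral_eq_zero (a := a) (b := b) (θ := θ)
      (cψ.sub (contDiff_const.mul c₀))
      (fun t ht => by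
        rw [hθ]
        simp only
        rw [image_eq_zero_of_notMem_tsupport fun h => ht (hab (Or.inl h)),
          image_eq_zero_of_notMem_tsupport fun h => ht (hab (Or.inr h))]
        simp)
      (by rw [integral_sub hψi (hχi.const_mul m), integral_const_mul, i₀, hm]; ring)
    have h1 := h Θ cΘ kΘ (sΘ.trans fun t ht => ⟨lt_of_lt_of_le ha ht.1, lt_of_le_of_lt ht.2 hb⟩)
    have iψ := integrable_mul_of_hasCompactSupport hloc cψ.continuous kψ sψ
    have iχ := integrable_mul_of_hasCompactSupport hloc c₀.continuous k₀ s₀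
    have h2 : ∀ t, e t * deriv Θ t = e t * ψ t - m * (e t * χ₀ t) := fun t => by
      rw [dΘ, hθ]; ring
    simp only [h2] at h1
    rw [integral_sub iψ.integrableOn (iχ.const_mul m).integrableOn, integral_const_mul, ← hc,
      setIntegral_eq_integral_of_forall_compl_eq_zero (fun t ht => by
        rw [image_eq_zero_of_notMem_tsupport fun h => ht (sψ h), mul_zero])] at h1
    have h3 : ∀ t, ψ t • (e t - c) = e t * ψ t - c * ψ t := fun t => by rw [smul_eq_mul]; ring
    simp only [h3]
    rw [integral_sub iψ (hψi.const_mul c), integral_const_mul, ← hm]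
    linarith
  refine ⟨c, fun t ht => ?_⟩
  have h4 : EqOn e (fun _ => c) (Ioo 0 T) := by
    refine Measure.eqOn_open_of_ae_eq (μ := volume) ?_ isOpen_Ioo (he.mono Ioo_subset_Icc_self)
      continuousOn_const
    rw [EventuallyEq, ae_restrict_iff' measurableSet_Ioo]
    filter_upwards [hae] with t h1 h2 using sub_eq_zero.1 (h1 h2)
  have h5 := h4.of_subset_closure he continuousOn_const Ioo_subset_Icc_self
    (by rw [closure_Ioo hT.ne])
  exact h5 ht

/-- The primitive of `k'` is absolutely continuous, so integration by parts gives it the same weak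
derivative as `k`; the difference is constant. -/
theorem sub_eq_integral_of_weak_deriv {T : ℝ} (hT : 0 < T) {k k' : ℝ → ℝ}
    (hk : ContinuousOn k (Icc 0 T)) (hk' : IntervalIntegrable k' volume 0 T)
    (h : ∀ χ : ℝ → ℝ, ContDiff ℝ ∞ χ → HasCompactSupport χ → tsupport χ ⊆ Ioo 0 T →
      ∫ t in Ioo 0 T, k t * deriv χ t = -∫ t in Ioo 0 T, k' t * χ t) :
    ∀ t ∈ Icc 0 T, k t - k 0 = ∫ s in (0 : ℝ)..t, k' s := by
  set K : ℝ → ℝ := fun t => ∫ s in (0 : ℝ)..t, k' s with hK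
  have hAC : AbsolutelyContinuousOnInterval K 0 T :=
    hk'.absolutelyContinuousOnInterval_intervalIntegral (by simp)
  have hKc : ContinuousOn K (Icc 0 T) := by
    have := hAC.continuousOn; rwa [uIcc_of_le hT.le] at this
  have hconst : ∀ χ : ℝ → ℝ, ContDiff ℝ ∞ χ → HasCompactSupport χ → tsupport χ ⊆ Ioo 0 T →
      ∫ t in Ioo 0 T, (k t - K t) * deriv χ t = 0 := by
    intro χ cχ kχ sχ
    have hχAC : AbsolutelyContinuousOnInterval χ 0 T := 
      (cχ.of_le (by simp)).contDiffOn.absolutelyContinuousOnInterval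
    have hχ0 : χ 0 = 0 := image_eq_zero_of_notMem_tsupport fun h => lt_irrefl _ (sχ h).1
    have hχT : χ T = 0 := image_eq_zero_of_notMem_tsupport fun h => lt_irrefl _ (sχ h).2
    have hparts := hAC.integral_mul_deriv_eq_deriv_mul hχAC
    rw [hχ0, hχT, mul_zero, mul_zero, sub_zero, zero_sub] at hparts
    have hdK : ∫ t in (0 : ℝ)..T, deriv K t * χ t = ∫ t in (0 : ℝ)..T, k' t * χ t := by
      refine intervalIntegral.integral_congr_ae ?_
      filter_upwards [hk'.ae_hasDerivAt_integral] with t ht htT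
      rw [(ht (uIoc_subset_uIcc htT) 0 (by simp)).deriv]
    have hcd : Continuous (deriv χ) := cχ.continuous_deriv (by simp)
    have i1 : IntegrableOn (fun t => k t * deriv χ t) (Ioo 0 T) :=
      ((hk.mul hcd.continuousOn).integrableOn_Icc).mono_set Ioo_subset_Icc_self
    have i2 : IntegrableOn (fun t => K t * deriv χ t) (Ioo 0 T) :=
      ((hKc.mul hcd.continuousOn).integrableOn_Icc).mono_set Ioo_subset_Icc_self
    simp only [sub_mul]
    rw [integral_sub i1 i2, h χ cχ kχ sχ, ← integral_Ioc_eq_integral_Ioo,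
      ← integral_Ioc_eq_integral_Ioo, ← intervalIntegral.integral_of_le hT.le,
      ← intervalIntegral.integral_of_le hT.le, hparts, hdK]
    ring
  obtain ⟨c, hc⟩ := exists_eq_const_of_integral_deriv_eq_zero hT (hk.sub hKc) hconst
  intro t ht
  have h0 := hc 0 ⟨le_rfl, hT.le⟩
  have h1 := hc t ht
  simp only [Pi.sub_apply, hK, intervalIntegral.integral_same] at h0 h1
  linarith

/-! ### Functions of time with values in `L^2` -/

/-- A point lies in a closed set exactly when its distance to a countable dense subset of that set
is zero. -/
theorem measurable_of_measurable_edist {S M : Type*} [MeasurableSpace S] [PseudoEMetricSpace M]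
    [SecondCountableTopology M] [MeasurableSpace M] [BorelSpace M] {f : S → M}
    (h : ∀ g, Measurable fun t => edist (f t) g) : Measurable f := by
  refine measurable_of_isClosed fun F hF => ?_
  obtain ⟨D, hDF, hDc, hFD⟩ :=
    (TopologicalSpace.IsSeparable.of_separableSpace F).exists_countable_dense_subset
  have hcl : closure D = F := (closure_minimal hDF hF).antisymm hFD
  have hpre : f ⁻¹' F = {t | ⨅ g ∈ D, edist (f t) g = 0} := by
    ext t
    rw [mem_preimage, ← hcl, Metric.mem_closure_iff_infEDist_zero]
    rfl
  rw [hpre]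
  exact (Measurable.biInf D hDc fun g _ => h g) (measurableSet_singleton 0)

section ToL2

variable {X E : Type*} [MeasurableSpace X] {μ : Measure X} [NormedAddCommGroup E]

open Classical in
/-- The class in `L^2` of a function, and `0` if the function is not in `L^2`. -/
noncomputable def toL2 (μ : Measure X) (f : X → E) : Lp E 2 μ :=
  if h : MemLp f 2 μ then h.toLp f else 0

theorem toL2_of_memLp {f : X → E} (h : MemLp f 2 μ) : toL2 μ f = h.toLp f := dif_pos h

theorem coeFn_toL2 {f : X → E} (h : MemLp f 2 μ) : toL2 μ f =ᵐ[μ] f := by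
  rw [toL2_of_memLp h]; exact h.coeFn_toLp

theorem toL2_congr {f g : X → E} (h : f =ᵐ[μ] g) : toL2 μ f = toL2 μ g := by
  by_cases hf : MemLp f 2 μ
  · rw [toL2_of_memLp hf, toL2_of_memLp (hf.ae_eq h), MemLp.toLp_eq_toLp_iff]
    exact h
  · rw [toL2, toL2, dif_neg hf, dif_neg fun hg => hf (hg.ae_eq h.symm)]

theorem norm_toL2 {f : X → E} (h : MemLp f 2 μ) : ‖toL2 μ f‖ = (eLpNorm f 2 μ).toReal := by
  rw [toL2_of_memLp h, Lp.norm_toLp]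

theorem edist_toL2 {f : X → E} (h : MemLp f 2 μ) (g : Lp E 2 μ) :
    edist (toL2 μ f) g = eLpNorm (fun x => f x - g x) 2 μ := by
  rw [Lp.edist_def]
  exact eLpNorm_congr_ae ((coeFn_toL2 h).sub .rfl)

theorem toL2_sub {f g : X → E} (hf : MemLp f 2 μ) (hg : MemLp g 2 μ) :
    toL2 μ (f - g) = toL2 μ f - toL2 μ g := by
  rw [toL2_of_memLp hf, toL2_of_memLp hg, toL2_of_memLp (hf.sub hg), MemLp.toLp_sub]

theorem toL2_add {f g : X → E} (hf : MemLp f 2 μ) (hg : MemLp g 2 μ) :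
    toL2 μ (f + g) = toL2 μ f + toL2 μ g := by
  rw [toL2_of_memLp hf, toL2_of_memLp hg, toL2_of_memLp (hf.add hg), MemLp.toLp_add]

theorem toL2_zero : toL2 μ (0 : X → E) = 0 := by
  have h : MemLp (0 : X → E) 2 μ := MemLp.zero
  rw [toL2_of_memLp h, MemLp.toLp_zero]

theorem toL2_const_smul [NormedSpace ℝ E] (c : ℝ) {f : X → E} (hf : MemLp f 2 μ) :
    toL2 μ (c • f) = c • toL2 μ f := by
  rw [toL2_of_memLp hf, toL2_of_memLp (hf.const_smul c), MemLp.toLp_const_smul]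

theorem inner_toL2 [InnerProductSpace ℝ E] {f g : X → E} (hf : MemLp f 2 μ) (hg : MemLp g 2 μ) :
    inner ℝ (toL2 μ f) (toL2 μ g) = ∫ x, inner ℝ (f x) (g x) ∂μ := by
  rw [L2.inner_def]
  refine integral_congr_ae ?_
  filter_upwards [coeFn_toL2 hf, coeFn_toL2 hg] with x h1 h2
  rw [h1, h2]

end ToL2

section Slices

variable {S X E : Type*} [MeasurableSpace S] [MeasurableSpace X] {ν : Measure S} {μ : Measure X}
  [NormedAddCommGroup E]

theorem ae_memLp_slice [SFinite ν] [SFinite μ] {r : ℝ≥0∞} (hr0 : r ≠ 0) (hr : r ≠ ⊤)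
    {f : S → X → E} (hf : MemLp (fun z : S × X => f z.1 z.2) r (ν.prod μ)) :
    ∀ᵐ t ∂ν, MemLp (f t) r μ := by
  have h1 := (eLpNorm_lt_top_iff_lintegral_rpow_enorm_lt_top hr0 hr).1 hf.2
  have hm : AEMeasurable (fun z : S × X => ‖f z.1 z.2‖ₑ ^ r.toReal) (ν.prod μ) :=
    hf.1.enorm.pow_const _
  rw [lintegral_prod _ hm] at h1
  filter_upwards [ae_lt_top' hm.lintegral_prod_right' h1.ne, hf.1.prodMk_left] with t ht hmt
  exact ⟨hmt, (eLpNorm_lt_top_iff_lintegral_rpow_enorm_lt_top hr0 hr).2 ht⟩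

theorem measurable_eLpNorm_slice [SFinite μ] {f : S → X → E}
    (hf : StronglyMeasurable fun z : S × X => f z.1 z.2) :
    Measurable fun t => eLpNorm (f t) 2 μ := by
  have h : ∀ t, eLpNorm (f t) 2 μ = (∫⁻ x, ‖f t x‖ₑ ^ (2 : ℝ) ∂μ) ^ (1 / 2 : ℝ) := fun t => by
    rw [eLpNorm_eq_lintegral_rpow_enorm_toReal two_ne_zero ENNReal.ofNat_ne_top]; simp
  simp only [h]
  refine Measurable.pow_const (Measurable.lintegral_prod_right' (ν := μ)
    (f := fun z : S × X => ‖f z.1 z.2‖ₑ ^ (2 : ℝ)) ?_) _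
  exact hf.enorm.pow_const _

/-- For a jointly measurable modification, the distance of a slice to a fixed class is measurable by
Tonelli. Slices outside `L²` are sent to `0` by `toL2`, hence the case distinction. -/
theorem aestronglyMeasurable_toL2 [SFinite ν] [SFinite μ] [SecondCountableTopology ↥(Lp E 2 μ)]
    {f : S → X → E}
    (hf : AEStronglyMeasurable (fun z : S × X => f z.1 z.2) (ν.prod μ)) :
    AEStronglyMeasurable (fun t => toL2 μ (f t)) ν := by
  borelize ↥(Lp E 2 μ)
  set f' : S → X → E := fun t x => hf.mk _ (t, x) with hf'
  have hsm : StronglyMeasurable fun z : S × X => f' z.1 z.2 := hf.stronglyMeasurable_mk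
  have hslice : ∀ t, AEStronglyMeasurable (f' t) μ := fun t =>
    (hsm.comp_measurable measurable_prodMk_left).aestronglyMeasurable
  have hmeas : Measurable fun t => toL2 μ (f' t) := by
    refine measurable_of_measurable_edist fun g => ?_
    have h2 : Measurable fun t => eLpNorm (fun x => f' t x - g x) 2 μ :=
      measurable_eLpNorm_slice (f := fun t x => f' t x - g x)
        (hsm.sub ((Lp.stronglyMeasurable g).comp_measurable measurable_snd))
    have h3 : (fun t => edist (toL2 μ (f' t)) g)
        = fun t => if eLpNorm (f' t) 2 μ < ⊤ then eLpNorm (fun x => f' t x - g x) 2 μ else edist 0 g := by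
      ext t
      split_ifs with h
      · exact edist_toL2 ⟨hslice t, h⟩ g
      · rw [toL2, dif_neg fun hm => h hm.2]
    rw [h3]
    exact Measurable.ite (measurableSet_lt (measurable_eLpNorm_slice hsm) measurable_const) h2
      measurable_const
  refine ⟨fun t => toL2 μ (f' t), hmeas.stronglyMeasurable, ?_⟩
  filter_upwards [Measure.ae_ae_of_ae_prod hf.ae_eq_mk] with t ht
  exact toL2_congr ht

theorem integrable_toL2 [IsFiniteMeasure ν] [SFinite μ] [SecondCountableTopology ↥(Lp E 2 μ)]
    {f : S → X → E} (hf : MemLp (fun z : S × X => f z.1 z.2) 2 (ν.prod μ)) :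
    Integrable (fun t => toL2 μ (f t)) ν := by
  refine MemLp.integrable one_le_two (q := 2) ⟨aestronglyMeasurable_toL2 hf.1, ?_⟩
  rw [eLpNorm_lt_top_iff_lintegral_rpow_enorm_lt_top two_ne_zero ENNReal.ofNat_ne_top]
  have h1 := (eLpNorm_lt_top_iff_lintegral_rpow_enorm_lt_top two_ne_zero ENNReal.ofNat_ne_top).1 hf.2
  rw [lintegral_prod _ (hf.1.enorm.pow_const _)] at h1
  refine lt_of_le_of_lt (lintegral_mono_ae ?_) h1
  filter_upwards [ae_memLp_slice two_ne_zero ENNReal.ofNat_ne_top hf] with t ht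
  rw [toL2_of_memLp ht, Lp.enorm_toLp,
    eLpNorm_eq_lintegral_rpow_enorm_toReal two_ne_zero ENNReal.ofNat_ne_top, ← ENNReal.rpow_mul]
  simp

end Slices

/-! ### Weak time derivatives as derivatives in `L²` -/

section TimeDerivative

variable {d : ℕ} {T : ℝ} {Ω : Set (Vec d)}

theorem restrict_cylinder :
    (volume : Measure (ℝ × Vec d)).restrict (cylinder T Ω)
      = (volume.restrict (Ioo 0 T)).prod (volume.restrict Ω) := by
  rw [Measure.prod_restrict, cylinder, Measure.volume_eq_prod]

/-- The test field `η e_i`. -/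
noncomputable def testField (i : Fin d) (η : Vec d → ℝ) (x : Vec d) : Vec d :=
  EuclideanSpace.single i (η x)

theorem memLp_testField (i : Fin d) {η : Vec d → ℝ} (hη : Continuous η)
    (hc : HasCompactSupport η) : MemLp (testField i η) 2 (volume.restrict Ω) := by
  have h : Continuous (testField i η) := by
    have : testField i η = fun x => η x • EuclideanSpace.single i (1 : ℝ) := by
      ext x j; simp [testField]
    rw [this]; fun_prop
  refine (h.memLp_of_hasCompactSupport (hc.mono ?_)).restrict Ω
  intro x hx h0
  exact hx (by simp [testField, h0])

theorem inner_toL2_testField (i : Fin d) {η : Vec d → ℝ} (hη : Continuous η)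
    (hc : HasCompactSupport η) {f : Vec d → Vec d} (hf : MemLp f 2 (volume.restrict Ω)) :
    inner ℝ (toL2 (volume.restrict Ω) (testField i η)) (toL2 (volume.restrict Ω) f)
      = ∫ x in Ω, f x i * η x := by
  rw [inner_toL2 (memLp_testField i hη hc) hf]
  refine integral_congr_ae (Eventually.of_forall fun x => ?_)
  simp [testField, EuclideanSpace.inner_single_left, mul_comm]

theorem eq_zero_of_inner_testField (hΩ : IsOpen Ω) [IsFiniteMeasure (volume.restrict Ω)]
    (v : Lp (Vec d) 2 (volume.restrict Ω))
    (h : ∀ (i : Fin d) (η : Vec d → ℝ), ContDiff ℝ ∞ η → HasCompactSupport η → tsupport η ⊆ Ω →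
      inner ℝ (toL2 (volume.restrict Ω) (testField i η)) v = 0) : v = 0 := by
  have hv : MemLp v 2 (volume.restrict Ω) := Lp.memLp v
  have hvi : ∀ i, LocallyIntegrableOn (fun x => v x i) Ω := fun i => by
    have h1 : MemLp (fun x => v x i) 2 (volume.restrict Ω) :=
      (EuclideanSpace.proj (𝕜 := ℝ) i).comp_memLp' hv
    exact IntegrableOn.locallyIntegrableOn (h1.integrable one_le_two)
  have hae : ∀ᵐ x ∂(volume.restrict Ω), ∀ i, v x i = 0 := by
    refine ae_all_iff.2 fun i => ?_
    rw [ae_restrict_iff' hΩ.measurableSet]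
    refine hΩ.ae_eq_zero_of_integral_contDiff_smul_eq_zero (hvi i) fun η cη kη sη => ?_
    have h1 := h i η cη kη sη
    have h2 : toL2 (volume.restrict Ω) v = v := by rw [toL2_of_memLp hv, Lp.toLp_coeFn]
    rw [← h2, inner_toL2_testField i cη.continuous kη hv,
      setIntegral_eq_integral_of_forall_compl_eq_zero fun x hx => by
        rw [image_eq_zero_of_notMem_tsupport fun h => hx (sη h), mul_zero]] at h1
    simpa only [smul_eq_mul, mul_comm] using h1
  rw [Lp.eq_zero_iff_ae_eq_zero]
  filter_upwards [hae] with x hx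
  ext i; exact hx i

variable {w w' : ℝ → Vec d → Vec d}

theorem IsW12Time.continuousOn_toL2 (h : IsW12Time T Ω w w') :
    ContinuousOn (fun t => toL2 (volume.restrict Ω) (w t)) (Icc 0 T) := by
  intro t ht
  rw [ContinuousWithinAt, tendsto_iff_edist_tendsto_0]
  refine (h.continuous t ht).congr' ?_
  filter_upwards [self_mem_nhdsWithin] with s hs
  rw [edist_toL2 (h.memLp_slice s hs)]
  exact eLpNorm_congr_ae ((Filter.EventuallyEq.refl _ _).sub (coeFn_toL2 (h.memLp_slice t ht)).symm)

theorem integral_cylinder_test {f : ℝ → Vec d → ℝ} {χ : ℝ → ℝ} {η : Vec d → ℝ}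
    (hf : LocallyIntegrableOn (fun z : ℝ × Vec d => f z.1 z.2) (cylinder T Ω))
    (hχ : Continuous χ) (kχ : HasCompactSupport χ) (sχ : tsupport χ ⊆ Ioo 0 T)
    (hη : Continuous η) (kη : HasCompactSupport η) (sη : tsupport η ⊆ Ω) :
    ∫ z in cylinder T Ω, f z.1 z.2 * (χ z.1 * η z.2)
      = ∫ t in Ioo 0 T, (∫ x in Ω, f t x * η x) * χ t := by
  have hsup : tsupport (fun z : ℝ × Vec d => χ z.1 * η z.2) ⊆ tsupport χ ×ˢ tsupport η := by
    refine closure_minimal (fun z hz => ?_) ((isClosed_tsupport χ).prod (isClosed_tsupport η))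
    exact ⟨subset_tsupport _ (left_ne_zero_of_mul hz), subset_tsupport _ (right_ne_zero_of_mul hz)⟩
  have hint : Integrable (fun z : ℝ × Vec d => f z.1 z.2 * (χ z.1 * η z.2)) :=
    integrable_mul_of_hasCompactSupport hf (by fun_prop)
      ((kχ.isCompact.prod kη.isCompact).of_isClosed_subset (isClosed_tsupport _) hsup)
      (hsup.trans (prod_mono sχ sη))
  have hint' := hint.integrableOn (s := cylinder T Ω)
  rw [IntegrableOn, restrict_cylinder] at hint'
  rw [restrict_cylinder, integral_prod _ hint']
  refine integral_congr_ae (Eventually.of_forall fun t => ?_)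
  simp only
  rw [← integral_mul_const]
  refine integral_congr_ae (Eventually.of_forall fun x => ?_)
  simp only; ring

/-- Product tests `χ(t) η(x) e_i` show that each scalar function `(w(t), η e_i)` has weak derivative
`(w'(t), η e_i)`, so the one-dimensional result applies. The fields `η e_i` separate `L²`, which
lifts the identity to the Bochner integral. -/
theorem IsW12Time.toL2_sub_eq_integral (hT : 0 < T) (hΩ : IsOpen Ω)
    [IsFiniteMeasure (volume.restrict Ω)] (h : IsW12Time T Ω w w') :
    IntervalIntegrable (fun t => toL2 (volume.restrict Ω) (w' t)) volume 0 T ∧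
    ∀ t ∈ Icc 0 T, toL2 (volume.restrict Ω) (w t) - toL2 (volume.restrict Ω) (w 0)
      = ∫ s in (0 : ℝ)..t, toL2 (volume.restrict Ω) (w' s) := by
  have hL := h.memLp_deriv
  rw [MemLpST, restrict_cylinder] at hL
  have : Fact ((2 : ℝ≥0∞) ≠ ⊤) := ⟨ENNReal.ofNat_ne_top⟩
  have hint : IntervalIntegrable (fun t => toL2 (volume.restrict Ω) (w' t)) volume 0 T := by
    rw [intervalIntegrable_iff_integrableOn_Ioo_of_le hT.le]
    exact integrable_toL2 hL
  refine ⟨hint, fun t ht => ?_⟩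
  have hint_t : IntervalIntegrable (fun t => toL2 (volume.restrict Ω) (w' t)) volume 0 t :=
    hint.mono_set (by rw [uIcc_of_le ht.1, uIcc_of_le hT.le]; exact Icc_subset_Icc_right ht.2)
  rw [← sub_eq_zero]
  refine eq_zero_of_inner_testField hΩ _ fun i η cη kη sη => ?_
  set φ := toL2 (volume.restrict Ω) (testField i η) with hφ
  have hscalar := sub_eq_integral_of_weak_deriv hT
    (k := fun t => inner ℝ φ (toL2 (volume.restrict Ω) (w t)))
    (k' := fun t => inner ℝ φ (toL2 (volume.restrict Ω) (w' t)))
    (continuousOn_const.inner h.continuousOn_toL2)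
    ⟨(innerSL ℝ φ).integrable_comp hint.1, (innerSL ℝ φ).integrable_comp hint.2⟩
    (fun χ cχ kχ sχ => ?_) t ht
  · rw [inner_sub_right, inner_sub_right, hscalar, sub_eq_zero]
    exact (innerSL ℝ φ).intervalIntegral_comp_comm hint_t
  · obtain ⟨l1, l2, htest⟩ := h.weak_deriv i
    have hcd : Continuous (deriv χ) := cχ.continuous_deriv (by simp)
    have hsup : tsupport (fun z : ℝ × Vec d => χ z.1 * η z.2) ⊆ tsupport χ ×ˢ tsupport η := by
      refine closure_minimal (fun z hz => ?_) ((isClosed_tsupport χ).prod (isClosed_tsupport η))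
      exact ⟨subset_tsupport _ (left_ne_zero_of_mul hz),
        subset_tsupport _ (right_ne_zero_of_mul hz)⟩
    have e := htest (fun z => χ z.1 * η z.2)
      ((cχ.comp contDiff_fst).mul (cη.comp contDiff_snd))
      ((kχ.isCompact.prod kη.isCompact).of_isClosed_subset (isClosed_tsupport _) hsup)
      (hsup.trans (prod_mono sχ sη))
    have hfd : ∀ z : ℝ × Vec d, fderiv ℝ (fun z : ℝ × Vec d => χ z.1 * η z.2) z (1, 0)
        = deriv χ z.1 * η z.2 := by
      intro z
      have h1 : HasFDerivAt (fun z : ℝ × Vec d => χ z.1) _ z :=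
        ((cχ.differentiable (by simp) z.1).hasDerivAt.hasFDerivAt).comp z hasFDerivAt_fst
      have h2 : HasFDerivAt (fun z : ℝ × Vec d => η z.2) _ z :=
        ((cη.differentiable (by simp) z.2).hasFDerivAt).comp z hasFDerivAt_snd
      have h3 : HasFDerivAt (fun z : ℝ × Vec d => χ z.1 * η z.2) _ z := h1.mul h2
      rw [h3.fderiv]
      simp [mul_comm]
    simp only [hfd] at e
    rw [integral_cylinder_test (f := fun t x => w t x i) l1 hcd kχ.deriv ((tsupport_deriv_subset).trans sχ) cη.continuous kη sη,
      integral_cylinder_test (f := fun t x => w' t x i) l2 cχ.continuous kχ sχ cη.continuous kη sη] at e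
    have e1 : ∫ t in Ioo 0 T, inner ℝ φ (toL2 (volume.restrict Ω) (w t)) * deriv χ t
        = ∫ t in Ioo 0 T, (∫ x in Ω, w t x i * η x) * deriv χ t := by
      refine setIntegral_congr_fun measurableSet_Ioo fun t ht => ?_
      simp only
      rw [hφ, inner_toL2_testField i cη.continuous kη (h.memLp_slice t (Ioo_subset_Icc_self ht))]
    have e2 : ∫ t in Ioo 0 T, inner ℝ φ (toL2 (volume.restrict Ω) (w' t)) * χ t
        = ∫ t in Ioo 0 T, (∫ x in Ω, w' t x i * η x) * χ t := by
      refine integral_congr_ae ?_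
      filter_upwards [ae_memLp_slice two_ne_zero ENNReal.ofNat_ne_top hL] with t ht
      rw [hφ, inner_toL2_testField i cη.continuous kη ht]
    rw [e1, e2, e]

/-- Lebesgue differentiation of the Bochner integral, valid for strong convergence in `L²`. -/
theorem IsW12Time.ae_hasDerivAt_toL2 (hT : 0 < T) (hΩ : IsOpen Ω)
    [IsFiniteMeasure (volume.restrict Ω)] (h : IsW12Time T Ω w w') :
    ∀ᵐ t ∂(volume.restrict (Ioo 0 T)), MemLp (w' t) 2 (volume.restrict Ω) ∧
      HasDerivAt (fun s => toL2 (volume.restrict Ω) (w s)) (toL2 (volume.restrict Ω) (w' t)) t := by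
  obtain ⟨hint, heq⟩ := h.toL2_sub_eq_integral hT hΩ
  have hL := h.memLp_deriv
  rw [MemLpST, restrict_cylinder] at hL
  filter_upwards [ae_memLp_slice two_ne_zero ENNReal.ofNat_ne_top hL,
    ae_restrict_of_ae hint.ae_hasDerivAt_integral, ae_restrict_mem measurableSet_Ioo]
    with t h1 h2 ht
  refine ⟨h1, ?_⟩
  have h3 := (h2 (by rw [uIcc_of_le hT.le]; exact Ioo_subset_Icc_self ht) 0 (by simp)).const_add
    (toL2 (volume.restrict Ω) (w 0))
  refine h3.congr_of_eventuallyEq ?_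
  filter_upwards [isOpen_Ioo.mem_nhds ht] with s hs
  rw [← heq s (Ioo_subset_Icc_self hs)]
  abel

end TimeDerivative

/-! ### The discrete velocity as a curve in `L^2` -/

section Discrete

variable {d : ℕ} {T : ℝ} {Ω : Set (Vec d)}

theorem l2norm_eq_norm_toL2 {X : Type*} [NormedAddCommGroup X] {w : Vec d → X}
    (h : MemLp w 2 (volume.restrict Ω)) : l2norm Ω w = ‖toL2 (volume.restrict Ω) w‖ :=
  (norm_toL2 h).symm

theorem l2norm_sq_eq_integral {X : Type*} [NormedAddCommGroup X] [InnerProductSpace ℝ X]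
    {w : Vec d → X} (h : MemLp w 2 (volume.restrict Ω)) :
    l2norm Ω w ^ 2 = ∫ x in Ω, ‖w x‖ ^ 2 := by
  rw [l2norm_eq_norm_toL2 h, ← real_inner_self_eq_norm_sq, inner_toL2 h h]
  simp only [real_inner_self_eq_norm_sq]

theorem toL2_sum_smul {ι X E : Type*} [MeasurableSpace X] {μ : Measure X} [NormedAddCommGroup E]
    [NormedSpace ℝ E] (s : Finset ι) (c : ι → ℝ) {f : ι → X → E} (hf : ∀ i, MemLp (f i) 2 μ) :
    MemLp (∑ i ∈ s, c i • f i) 2 μ ∧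
      toL2 μ (∑ i ∈ s, c i • f i) = ∑ i ∈ s, c i • toL2 μ (f i) := by
  classical
  induction s using Finset.induction_on with
  | empty =>
    rw [Finset.sum_empty, Finset.sum_empty]
    exact ⟨MemLp.zero, toL2_zero⟩
  | insert i s hi ih =>
    have h1 : MemLp (c i • f i) 2 μ := (hf i).const_smul _
    rw [Finset.sum_insert hi, Finset.sum_insert hi, ← ih.2, ← toL2_const_smul _ (hf i)]
    exact ⟨h1.add ih.1, toL2_add h1 ih.1⟩

/-- Only finitely many scalar coefficients depend on time, so the pointwise derivative and the
derivative in `L²` agree. At interior times the derivative within `[0, T]` is two-sided. -/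
theorem IsC1Curve.hasDerivAt_toL2 {V : Set (Vec d → Vec d)} {w : ℝ → Vec d → Vec d}
    (hV : ∀ v ∈ V, MemLp v 2 (volume.restrict Ω)) (h : IsC1Curve T V w) {t : ℝ}
    (ht : t ∈ Ioo 0 T) : MemLp (timeDeriv T w t) 2 (volume.restrict Ω) ∧
      HasDerivAt (fun s => toL2 (volume.restrict Ω) (w s))
        (toL2 (volume.restrict Ω) (timeDeriv T w t)) t := by
  obtain ⟨n, ξ, α, hξ, hα, hw⟩ := h
  have hT : 0 < T := ht.1.trans ht.2
  have htI := Ioo_subset_Icc_self ht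
  have hd : ∀ i, HasDerivWithinAt (α i) (derivWithin (α i) (Icc 0 T) t) (Icc 0 T) t := fun i =>
    ((hα i).differentiableOn (by simp) t htI).hasDerivWithinAt
  have hsum : ∀ s ∈ Icc 0 T, w s = ∑ i, α i s • ξ i := fun s hs => by
    ext1 x; rw [hw s hs x]; simp
  have htd : timeDeriv T w t = ∑ i, derivWithin (α i) (Icc 0 T) t • ξ i := by
    ext1 x
    have h1 : HasDerivWithinAt (fun s => w s x)
        (∑ i, derivWithin (α i) (Icc 0 T) t • ξ i x) (Icc 0 T) t :=
      (HasDerivWithinAt.fun_sum fun i _ => (hd i).smul_const (ξ i x)).congr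
        (fun s hs => hw s hs x) (hw t htI x)
    rw [timeDeriv, h1.derivWithin (uniqueDiffOn_Icc hT t htI)]
    simp
  have hξ2 : ∀ i, MemLp (ξ i) 2 (volume.restrict Ω) := fun i => hV _ (hξ i)
  obtain ⟨m1, e1⟩ := toL2_sum_smul Finset.univ (fun i => derivWithin (α i) (Icc 0 T) t) hξ2
  rw [htd]
  refine ⟨m1, ?_⟩
  rw [e1]
  have h2 : HasDerivAt (fun s => ∑ i, α i s • toL2 (volume.restrict Ω) (ξ i))
      (∑ i, derivWithin (α i) (Icc 0 T) t • toL2 (volume.restrict Ω) (ξ i)) t :=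
    HasDerivAt.fun_sum fun i _ =>
      ((hd i).hasDerivAt (Icc_mem_nhds ht.1 ht.2)).smul_const _
  refine h2.congr_of_eventuallyEq ?_
  filter_upwards [Icc_mem_nhds ht.1 ht.2] with s hs
  rw [hsum s hs]
  exact (toL2_sum_smul Finset.univ (fun i => α i s) hξ2).2

variable {p : ℝ} {𝒯 : Triangulation Ω} {k r : ℕ}

theorem IsC1Curve.mem_Vh (hp : 1 < p) (hΩ : IsOpen Ω) {w : ℝ → Vec d → Vec d} {v₀ : Vec d → Vec d}
    (hv₀ : v₀ ∈ Vh 𝒯 p k r) (h : IsC1Curve T (Vh 𝒯 p k r) w) {t : ℝ} (ht : t ∈ Icc 0 T) :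
    w t ∈ Vh 𝒯 p k r := by
  obtain ⟨n, ξ, α, hξ, -, hw⟩ := h
  have hsum : w t = ∑ i, α i t • ξ i := by
    ext1 x; rw [hw t ht x]; simp
  rw [hsum]
  exact Vh.sum hp hΩ hv₀ _ _ hξ

end Discrete

/-- The squared norm of a Hilbert space is differentiated along the curve of classes. Membership in
`L²` near `t` is needed because `toL2` represents a function only then. -/
theorem hasDerivAt_l2norm_sq {d : ℕ} {Ω : Set (Vec d)} {u v : ℝ → Vec d → Vec d}
    {u' v' : Vec d → Vec d} {t : ℝ}
    (hu : ∀ᶠ s in 𝓝 t, MemLp (u s) 2 (volume.restrict Ω))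
    (hv : ∀ᶠ s in 𝓝 t, MemLp (v s) 2 (volume.restrict Ω))
    (hu' : MemLp u' 2 (volume.restrict Ω)) (hv' : MemLp v' 2 (volume.restrict Ω))
    (du : HasDerivAt (fun s => toL2 (volume.restrict Ω) (u s)) (toL2 (volume.restrict Ω) u') t)
    (dv : HasDerivAt (fun s => toL2 (volume.restrict Ω) (v s)) (toL2 (volume.restrict Ω) v') t) :
    HasDerivAt (fun s => l2norm Ω (fun x => u s x - v s x) ^ 2)
      (2 * ∫ x in Ω, inner ℝ (u' x - v' x) (u t x - v t x)) t := by
  have hd := (du.sub dv).norm_sq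
  have hval : 2 * inner ℝ (((fun s => toL2 (volume.restrict Ω) (u s))
        - fun s => toL2 (volume.restrict Ω) (v s)) t)
        (toL2 (volume.restrict Ω) u' - toL2 (volume.restrict Ω) v')
      = 2 * ∫ x in Ω, inner ℝ (u' x - v' x) (u t x - v t x) := by
    have h1 : ((fun s => toL2 (volume.restrict Ω) (u s))
        - fun s => toL2 (volume.restrict Ω) (v s)) t = toL2 (volume.restrict Ω) (u t - v t) :=
      (toL2_sub hu.self_of_nhds hv.self_of_nhds).symm
    rw [h1, ← toL2_sub hu' hv', real_inner_comm,
      inner_toL2 (hu'.sub hv') (hu.self_of_nhds.sub hv.self_of_nhds)]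
    rfl
  rw [hval] at hd
  refine hd.congr_of_eventuallyEq ?_
  filter_upwards [hu, hv] with s h1 h2
  have h3 : l2norm Ω (fun x => u s x - v s x) = _ := l2norm_eq_norm_toL2 (h1.sub h2)
  have h4 : toL2 (volume.restrict Ω) (fun x => u s x - v s x) = _ := toL2_sub h1 h2
  rw [h3, h4]
  rfl

/-! ### The error estimate at a fixed time -/

theorem exists_slice_estimate (d : ℕ) {p : ℝ} (hp : 1 < p) {κ : ℝ}
    (hκp : κ < 8 * (p - 1) / p ^ 2) :
    ∃ c : ℝ, 0 < c ∧ ∀ (δ : ℝ), 0 ≤ δ → ∀ (Ω : Set (Vec d)), IsOpen Ω →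
      IsFiniteMeasure ((volume : Measure (Vec d)).restrict Ω) →
      ∀ (𝒯 : Triangulation Ω) (k r : ℕ) (u u' v v' : Vec d → Vec d) (q : Vec d → ℝ),
      MemW0 Ω p u → MemLp u 2 (volume.restrict Ω) → MemLp u' 2 (volume.restrict Ω) →
      v ∈ Vh 𝒯 p k r → MemLp v' 2 (volume.restrict Ω) →
      MemLp q (ENNReal.ofReal (conjExp p)) (volume.restrict Ω) →
      (∀ ξ ∈ Vh 𝒯 p k r, (∫ x in Ω, inner ℝ (u' x - v' x) (ξ x))
        + (∫ x in Ω, inner ℝ (stress p δ (symGrad Ω u x) - stress p δ (symGrad Ω v x))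
            (symGrad Ω ξ x)) - (∫ x in Ω, q x * divergence Ω ξ x) = 0) →
      ∀ ζ ∈ Vh 𝒯 p k r, ∀ μ ∈ Yh 𝒯 p r,
        2 * (∫ x in Ω, inner ℝ (u' x - v' x) (u x - v x))
            + κ * l2norm Ω (fun x => tensorF p δ (symGrad Ω u x)
                - tensorF p δ (symGrad Ω v x)) ^ 2
          ≤ c * (l2norm Ω (fun x => u' x - v' x) * l2norm Ω (fun x => u x - ζ x)
              + l2norm Ω (fun x => tensorF p δ (symGrad Ω u x)
                - tensorF p δ (symGrad Ω ζ x)) ^ 2)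
            + c * ∫ x in Ω, complementary (shiftedPhi p δ ‖symGrad Ω u x‖) |q x - μ x| := by
  obtain ⟨c, hc, hpt⟩ := exists_pointwise_estimate (E := Ten d) hp hκp (norm_nonneg (traceL d))
  -- `c` comes from the pointwise estimate, and `2` from the derivative of the square in front of
  -- the Cauchy-Schwarz term.
  refine ⟨c + 2, by linarith, ?_⟩
  intro δ hδ Ω hΩ _ 𝒯 k r u u' v v' q hu hu2 hu' hv hv' hq heq ζ hζ μ hμ
  have hconj := holderConjugate_conjExp hp
  have hv2 : MemLp v 2 (volume.restrict Ω) := Xh.memLp_two hΩ.measurableSet hv.1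
  have hζ2 : MemLp ζ 2 (volume.restrict Ω) := Xh.memLp_two hΩ.measurableSet hζ.1
  have hξ : ζ - v ∈ Vh 𝒯 p k r := Vh.sub hp hΩ hζ hv
  have hξ2 : MemLp (ζ - v) 2 (volume.restrict Ω) := hζ2.sub hv2
  have mu := hu.memLp_symGrad hΩ
  have mv := hv.1.1.memLp_symGrad hΩ
  have mζ := hζ.1.1.memLp_symGrad hΩ
  have mS := (memLp_stress hp hδ mu).sub (memLp_stress hp hδ mv)
  have mFv := (memLp_tensorF hp hδ mu).sub (memLp_tensorF hp hδ mv)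
  have mFζ := (memLp_tensorF hp hδ mu).sub (memLp_tensorF hp hδ mζ)
  have hw' : MemLp (u' - v') 2 (volume.restrict Ω) := hu'.sub hv'
  have hqμ : MemLp (q - μ) (ENNReal.ofReal (conjExp p)) (volume.restrict Ω) := hq.sub hμ.1
  -- the time derivative tested with `u - v = (u - ζ) + (ζ - v)`
  have hsplit : ∫ x in Ω, inner ℝ (u' x - v' x) (u x - v x)
      = (∫ x in Ω, inner ℝ (u' x - v' x) (u x - ζ x))
        + ∫ x in Ω, inner ℝ (u' x - v' x) ((ζ - v) x) := by
    refine Eq.trans ?_ (integral_add (integrable_inner_of_memLp hw' (hu2.sub hζ2))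
      (integrable_inner_of_memLp hw' hξ2))
    refine integral_congr_ae (Eventually.of_forall fun x => ?_)
    simp only [Pi.sub_apply, ← inner_add_right]
    congr 1; abel
  have hcs : ∫ x in Ω, inner ℝ (u' x - v' x) (u x - ζ x)
      ≤ l2norm Ω (fun x => u' x - v' x) * l2norm Ω (fun x => u x - ζ x) := by
    have h1 := real_inner_le_norm (toL2 (volume.restrict Ω) (u' - v'))
      (toL2 (volume.restrict Ω) (u - ζ))
    rw [inner_toL2 hw' (hu2.sub hζ2), ← l2norm_eq_norm_toL2 hw',
      ← l2norm_eq_norm_toL2 (hu2.sub hζ2)] at h1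
    exact h1
  -- the error equation
  have herr := heq _ hξ
  have hq0 : ∫ x in Ω, q x * divergence Ω (ζ - v) x
      = ∫ x in Ω, (q x - μ x) * divergence Ω (ζ - v) x := by
    have h1 := integral_sub (integrable_mul_divergence hp hΩ hq hξ.1.1)
      (integrable_mul_divergence hp hΩ hμ.1 hξ.1.1)
    rw [hξ.2 μ hμ, sub_zero] at h1
    rw [← h1]
    refine integral_congr_ae (Eventually.of_forall fun x => ?_)
    simp only; ring
  rw [hq0] at herr
  have i1 : Integrable (fun x => inner ℝ (stress p δ (symGrad Ω u x) - stress p δ (symGrad Ω v x))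
      (symGrad Ω (ζ - v) x)) (volume.restrict Ω) :=
    (integrable_inner_of_memLp (hξ.1.1.memLp_symGrad hΩ) mS).congr
      (Eventually.of_forall fun x => real_inner_comm _ _)
  have i2 : Integrable (fun x => (q x - μ x) * divergence Ω (ζ - v) x) (volume.restrict Ω) :=
    integrable_mul_divergence hp hΩ hqμ hξ.1.1
  have i3 := mFv.integrable_norm_pow two_ne_zero
  have i4 := mFζ.integrable_norm_pow two_ne_zero
  have i5 := integrable_complementary hp hδ mu hqμ
  have hmono : ∫ x in Ω, (-2 * inner ℝ (stress p δ (symGrad Ω u x) - stress p δ (symGrad Ω v x))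
          (symGrad Ω (ζ - v) x) + 2 * ((q x - μ x) * divergence Ω (ζ - v) x)
          + κ * ‖tensorF p δ (symGrad Ω u x) - tensorF p δ (symGrad Ω v x)‖ ^ 2)
      ≤ ∫ x in Ω, (c * ‖tensorF p δ (symGrad Ω u x) - tensorF p δ (symGrad Ω ζ x)‖ ^ 2
          + c * complementary (shiftedPhi p δ ‖symGrad Ω u x‖) |q x - μ x|) := by
    refine integral_mono_ae (((i1.const_mul _).add (i2.const_mul _)).add (i3.const_mul _))
      ((i4.const_mul _).add (i5.const_mul _)) ?_
    filter_upwards [hζ.1.1.weakGrad_sub hΩ hv.1.1] with x hx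
    have hD : symGrad Ω (ζ - v) x = symGrad Ω ζ x - symGrad Ω v x := by
      rw [symGrad, hx, Pi.sub_apply, symPart_sub]; rfl
    -- The trace ignores the antisymmetric part, so the divergence is controlled by the symmetric
    -- gradient alone, without Korn's inequality.
    have hdiv : divergence Ω (ζ - v) x = traceL d (symGrad Ω ζ x - symGrad Ω v x) := by
      rw [← hD, traceL_apply, symGrad, trace_symPart]; rfl
    have hqd : (q x - μ x) * divergence Ω (ζ - v) x
        ≤ ‖traceL d‖ * |q x - μ x| * ‖symGrad Ω ζ x - symGrad Ω v x‖ := by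
      refine (le_abs_self _).trans ?_
      rw [abs_mul, hdiv, mul_comm ‖traceL d‖, mul_assoc]
      exact mul_le_mul_of_nonneg_left ((traceL d).le_opNorm _) (abs_nonneg _)
    have h := hpt δ hδ (symGrad Ω u x) (symGrad Ω v x) (symGrad Ω ζ x) |q x - μ x| (abs_nonneg _)
    have hs : ∀ w : Vec d → Vec d, symPart (symGrad Ω w x) = symGrad Ω w x := fun w =>
      symPart_symPart _
    simp only [stress_eq_powField, tensorF_eq_powField, hs, hD]
    have hdec : symGrad Ω ζ x - symGrad Ω v x
        = (symGrad Ω u x - symGrad Ω v x) - (symGrad Ω u x - symGrad Ω ζ x) := by abel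
    have hin : inner ℝ (powField δ (p - 2) (symGrad Ω u x) - powField δ (p - 2) (symGrad Ω v x))
          (symGrad Ω ζ x - symGrad Ω v x)
        = inner ℝ (powField δ (p - 2) (symGrad Ω u x) - powField δ (p - 2) (symGrad Ω v x))
            (symGrad Ω u x - symGrad Ω v x)
          - inner ℝ (powField δ (p - 2) (symGrad Ω u x) - powField δ (p - 2) (symGrad Ω v x))
            (symGrad Ω u x - symGrad Ω ζ x) := by
      rw [hdec, inner_sub_right]
    linarith
  have e1 : ∫ x in Ω, (-2 * inner ℝ (stress p δ (symGrad Ω u x) - stress p δ (symGrad Ω v x))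
          (symGrad Ω (ζ - v) x) + 2 * ((q x - μ x) * divergence Ω (ζ - v) x)
          + κ * ‖tensorF p δ (symGrad Ω u x) - tensorF p δ (symGrad Ω v x)‖ ^ 2)
      = -2 * (∫ x in Ω, inner ℝ (stress p δ (symGrad Ω u x) - stress p δ (symGrad Ω v x))
          (symGrad Ω (ζ - v) x)) + 2 * (∫ x in Ω, (q x - μ x) * divergence Ω (ζ - v) x)
        + κ * ∫ x in Ω, ‖tensorF p δ (symGrad Ω u x) - tensorF p δ (symGrad Ω v x)‖ ^ 2 := by
    rw [← integral_const_mul, ← integral_const_mul, ← integral_const_mul,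
      ← integral_add (i1.const_mul _) (i2.const_mul _)]
    exact integral_add ((i1.const_mul _).add (i2.const_mul _)) (i3.const_mul _)
  have e2 : ∫ x in Ω, (c * ‖tensorF p δ (symGrad Ω u x) - tensorF p δ (symGrad Ω ζ x)‖ ^ 2
          + c * complementary (shiftedPhi p δ ‖symGrad Ω u x‖) |q x - μ x|)
      = c * (∫ x in Ω, ‖tensorF p δ (symGrad Ω u x) - tensorF p δ (symGrad Ω ζ x)‖ ^ 2)
        + c * ∫ x in Ω, complementary (shiftedPhi p δ ‖symGrad Ω u x‖) |q x - μ x| := by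
    rw [← integral_const_mul, ← integral_const_mul]
    exact integral_add (i4.const_mul _) (i5.const_mul _)
  rw [e1, e2] at hmono
  have n3 : l2norm Ω (fun x => tensorF p δ (symGrad Ω u x) - tensorF p δ (symGrad Ω v x)) ^ 2
      = _ := l2norm_sq_eq_integral mFv
  have n4 : l2norm Ω (fun x => tensorF p δ (symGrad Ω u x) - tensorF p δ (symGrad Ω ζ x)) ^ 2
      = _ := l2norm_sq_eq_integral mFζ
  have p0 : 0 ≤ c * (l2norm Ω (fun x => u' x - v' x) * l2norm Ω (fun x => u x - ζ x)) := by
    unfold l2norm; positivity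
  have p4 : 0 ≤ ∫ x in Ω, ‖tensorF p δ (symGrad Ω u x) - tensorF p δ (symGrad Ω ζ x)‖ ^ 2 :=
    integral_nonneg fun x => by positivity
  have p5 : 0 ≤ ∫ x in Ω, complementary (shiftedPhi p δ ‖symGrad Ω u x‖) |q x - μ x| :=
    integral_nonneg fun x => complementary_nonneg hp hδ (norm_nonneg _) (abs_nonneg _)
  rw [n3, n4, hsplit]
  simp only [Pi.sub_apply] at herr hmono hcs ⊢
  nlinarith

/-- The two parameters are independent, so the infima are taken one after the other. Nonemptiness
matters, as an empty real infimum is `0`. -/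
theorem le_mul_iInf_add_mul_iInf {ι ι' : Type*} [Nonempty ι] [Nonempty ι'] {c L : ℝ} (hc : 0 ≤ c)
    {A : ι → ℝ} {B : ι' → ℝ} (h : ∀ i j, L ≤ c * A i + c * B j) :
    L ≤ c * (⨅ i, A i) + c * ⨅ j, B j := by
  rw [Real.mul_iInf_of_nonneg hc, Real.mul_iInf_of_nonneg hc, ← sub_le_iff_le_add]
  refine le_ciInf fun i => ?_
  rw [sub_le_iff_le_add, ← sub_le_iff_le_add']
  exact le_ciInf fun j => by linarith [h i j]

/-- The error equation: the difference of the continuous and the discrete problem. -/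
theorem error_equation {d : ℕ} {p δ : ℝ} (hp : 1 < p) (hδ : 0 ≤ δ) {Ω : Set (Vec d)}
    (hΩ : IsOpen Ω) [IsFiniteMeasure (volume.restrict Ω)] {u u' v v' f ξ : Vec d → Vec d}
    {q : Vec d → ℝ} (hu : MemW0 Ω p u) (hv : MemW0 Ω p v)
    (hu' : MemLp u' 2 (volume.restrict Ω)) (hv' : MemLp v' 2 (volume.restrict Ω))
    (hξ : MemW0 Ω p ξ) (hξ2 : MemLp ξ 2 (volume.restrict Ω))
    (h₁ : (∫ x in Ω, inner ℝ (u' x) (ξ x))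
      + (∫ x in Ω, inner ℝ (stress p δ (symGrad Ω u x)) (symGrad Ω ξ x))
      - (∫ x in Ω, q x * divergence Ω ξ x) = ∫ x in Ω, inner ℝ (f x) (ξ x))
    (h₂ : (∫ x in Ω, inner ℝ (v' x) (ξ x))
      + (∫ x in Ω, inner ℝ (stress p δ (symGrad Ω v x)) (symGrad Ω ξ x))
      = ∫ x in Ω, inner ℝ (f x) (ξ x)) :
    (∫ x in Ω, inner ℝ (u' x - v' x) (ξ x))
      + (∫ x in Ω, inner ℝ (stress p δ (symGrad Ω u x) - stress p δ (symGrad Ω v x))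
          (symGrad Ω ξ x)) - (∫ x in Ω, q x * divergence Ω ξ x) = 0 := by
  have hconj := holderConjugate_conjExp hp
  have hint : ∀ w, MemW0 Ω p w → Integrable (fun x => inner ℝ (stress p δ (symGrad Ω w x))
      (symGrad Ω ξ x)) (volume.restrict Ω) := fun w hw =>
    (integrable_inner_of_memLp (hξ.memLp_symGrad hΩ) (memLp_stress hp hδ (hw.memLp_symGrad hΩ))).congr
      (Eventually.of_forall fun x => real_inner_comm _ _)
  simp only [inner_sub_left]
  rw [integral_sub (integrable_inner_of_memLp hu' hξ2) (integrable_inner_of_memLp hv' hξ2),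
    integral_sub (hint u hu) (hint v hv)]
  linarith

end PStokes

/-! ### The error estimate -/

open PStokes
theorem mainTheorem5 (d : ℕ) (hd : 2 ≤ d) (p : ℝ) (hp : 1 < p)
    (hpd : 2 * (d : ℝ) / ((d : ℝ) + 2) ≤ p)
    (κ : ℝ) (hκ : 0 < κ) (hκp : κ < 8 * (p - 1) / p ^ 2) :
    ∃ c : ℝ, 0 < c ∧
      ∀ (δ : ℝ), 0 ≤ δ → δ ≤ 1 →
      ∀ (T : ℝ), 0 < T →
      ∀ (Ω : Set (Vec d)), IsOpen Ω → IsConnected Ω → Bornology.IsBounded Ω →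
      ∀ (𝒯 : Triangulation Ω) (k r : ℕ)
        (f : ℝ → Vec d → Vec d) (u₀ : Vec d → Vec d)
        (u ut : ℝ → Vec d → Vec d) (q : ℝ → Vec d → ℝ)
        (u₀h : Vec d → Vec d) (uh : ℝ → Vec d → Vec d),
      IsWeakSolution p δ T Ω f u₀ u ut q →
      IsRegularSolution p δ T Ω f u₀ u ut q →
      IsDiscreteInitial p δ 𝒯 k r u₀ u₀h →
      IsDiscreteSolution p δ T 𝒯 k r f u₀h uh →
      ∀ᵐ t ∂(volume.restrict (Ioo 0 T)),
        DifferentiableAt ℝ (fun s => l2norm Ω (fun x => u s x - uh s x) ^ 2) t ∧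
        deriv (fun s => l2norm Ω (fun x => u s x - uh s x) ^ 2) t
            + κ * l2norm Ω (fun x => tensorF p δ (symGrad Ω (u t) x)
                - tensorF p δ (symGrad Ω (uh t) x)) ^ 2
          ≤ c * (⨅ ζ : Vh 𝒯 p k r,
                (l2norm Ω (fun x => ut t x - timeDeriv T uh t x)
                    * l2norm Ω (fun x => u t x - (ζ : Vec d → Vec d) x)
                  + l2norm Ω (fun x => tensorF p δ (symGrad Ω (u t) x)
                      - tensorF p δ (symGrad Ω (ζ : Vec d → Vec d) x)) ^ 2))
            + c * (⨅ μ : Yh 𝒯 p r,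
                ∫ x in Ω, complementary (shiftedPhi p δ ‖symGrad Ω (u t) x‖)
                  |q t x - (μ : Vec d → ℝ) x|) := by
  obtain ⟨c, hc, hest⟩ := exists_slice_estimate d hp hκp
  refine ⟨c, hc, ?_⟩
  intro δ hδ _ T hT Ω hΩ _ hb 𝒯 k r f u₀ u ut q u₀h uh hw hr hi hd
  have hfin : IsFiniteMeasure ((volume : Measure (Vec d)).restrict Ω) :=
    ⟨by rw [Measure.restrict_apply_univ]; exact hb.measure_lt_top⟩
  have hVh : ∀ v ∈ Vh 𝒯 p k r, MemLp v 2 (volume.restrict Ω) := fun v hv =>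
    Xh.memLp_two hΩ.measurableSet hv.1
  have hp0 : 0 < conjExp p := div_pos (by linarith) (by linarith)
  have hq := hw.memLp_pressure
  rw [MemLpST, restrict_cylinder] at hq
  -- The exceptional times are fixed before `ζ` and `μ` are chosen, since the weak equation holds at
  -- each good time for all test fields; the uncountable infima are therefore harmless.
  filter_upwards [hr.velocity_time.ae_hasDerivAt_toL2 hT hΩ, hw.memW0div, hw.equation,
    ae_memLp_slice (by simpa using hp0) ENNReal.ofReal_ne_top hq, ae_restrict_mem measurableSet_Ioo]
    with t ⟨hut, hdu⟩ hudiv heq hqt ht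
  have htI := Ioo_subset_Icc_self ht
  obtain ⟨hut', hduh⟩ := hd.regular.hasDerivAt_toL2 hVh ht
  have huh : ∀ s ∈ Icc 0 T, uh s ∈ Vh 𝒯 p k r := fun s hs =>
    hd.regular.mem_Vh hp hΩ hi.1 hs
  have hder := hasDerivAt_l2norm_sq
    (by filter_upwards [Icc_mem_nhds ht.1 ht.2] with s hs using hr.velocity_time.memLp_slice s hs)
    (by filter_upwards [Icc_mem_nhds ht.1 ht.2] with s hs using hVh _ (huh s hs))
    hut hut' hdu hduh
  refine ⟨hder.differentiableAt, ?_⟩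
  rw [hder.deriv]
  have : Nonempty (Vh 𝒯 p k r) := ⟨⟨u₀h, hi.1⟩⟩
  have : Nonempty (Yh 𝒯 p r) := ⟨⟨0, zero_mem_Yh⟩⟩
  refine le_mul_iInf_add_mul_iInf hc.le fun ζ μ => ?_
  exact hest δ hδ Ω hΩ hfin 𝒯 k r (u t) (ut t) (uh t) (timeDeriv T uh t) (q t) hudiv.1
    (hr.velocity_time.memLp_slice t htI) hut (huh t htI) hut' hqt
    (fun ξ hξ => error_equation hp hδ hΩ hudiv.1 (huh t htI).1.1 hut hut' hξ.1.1 (hVh ξ hξ)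
      (heq ξ hξ.1.1) (hd.equation t htI ξ hξ)) ζ ζ.2 μ μ.2
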